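/- Let $K$ be an algebraically closed field of characteristic zero, let $m\ge 1$ and $N=2m$. Let $A_N=K[t_1^{\pm1},\dots,t_N^{\pm1}]$, let $d_i=t_i\,\partial/\partial t_i$, and for $u\in K^N$, $r\in\mathbb Z^N$ put $D(u,r)=\sum_{i} u_i t^r d_i\in \operatorname{Der}_K(A_N)$. Let $J=\begin{pmatrix}0&I_m\\-I_m&0\end{pmatrix}$ and $h_r=D(Jr,r)$. Let $\mathcal H_N=\operatorname{span}_K\{h_r: r\in\mathbb Z^N\}+\{D(u,0):u\in K^N\}$, a Lie subalgebra of $\operatorname{Der}_K(A_N)$ (the Hamiltonian Lie algebra of the $N$-torus), and let $\mathcal H_N'=[\mathcal H_N,\mathcal H_N]$. Let $$\mathbf{GSp}_N(\mathbb Z)=\{Q\in \mathbf{GL}_N(\mathbb Z): Q^{\top}JQ=c(Q)J\ \text{for some } c(Q)\in\{1,-1\}\},$$ and for $\lambda\in(K^\times)^N$ and $r\in\mathbb Z^N$ write $\lambda^r=\prod_i\lambda_i^{r_i}$ and $|r|=\sum_i r_i$. The group $\mathbf{GSp}_N(\mathbb Z)$ acts on $(K^\times)^N$ by automorphisms, $(Q\cdot\lambda)^r=\lambda^{Q^{-1}r}$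 for all $r$. **Theorem.** (1) The group of $K$-linear Lie algebra automorphisms of $\mathcal H_N'$ satisfies $$\operatorname{Aut}(\mathcal H_N')\cong \mathbf{GSp}_N(\mathbb Z)\ltimes (K^\times)^N ,$$ where the semidirect product is formed with the above action. More precisely, there is an isomorphism under which the product $Q\lambda$ of $Q\in\mathbf{GSp}_N(\mathbb Z)$ and $\lambda\in(K^\times)^N$ corresponds to the automorphism $h_r\mapsto c(Q)\,\lambda^r h_{Qr}$ $(r\in\mathbb Z^N\setminus\{0\})$. (2) For every automorphism $\sigma$ of $\mathcal H_N'$ there is exactly one pair $(Q,\lambda)\in\mathbf{GSp}_N(\mathbb Z)\times(K^\times)^N$ such that, for all $r\in\mathbb Z^N\setminus\{0\}$, $$\sigma(h_r)=\begin{cases}\lambda^r\,h_{Qr}, & \text{if } Q^{\top}JQ=J,\\ -(-1)^{|r|}\lambda^r\,h_{Qr}, & \text{if } Q^{\top}JQ=-J.\end{cases}$$ (3) Conversely, for every such pair $(Q,\lambda)$ there is exactly one automorphism $\sigma$ of $\mathcal H_N'$ given by this formula. -/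

import Mathlib

open scoped Matrix

namespace TorusHamiltonian

noncomputable section

/-! ### Lie algebra automorphisms form a group -/

/-- The group of `K`-linear Lie algebra automorphisms of `L`. -/
abbrev LieAut (K L : Type*) [CommRing K] [LieRing L] [LieAlgebra K L] : Type _ := L ≃ₗ⁅K⁆ L

/-- The group structure on Lie algebra automorphisms: multiplication is composition. -/
instance LieAut.instGroup (K L : Type*) [CommRing K] [LieRing L] [LieAlgebra K L] :
    Group (LieAut K L) where
  mul f g := LieEquiv.trans g f
  one := LieEquiv.refl
  inv f := f.symm
  mul_assoc _ _ _ := rfl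
  one_mul _ := rfl
  mul_one _ := rfl
  inv_mul_cancel f := by
    ext x
    exact f.symm_apply_apply x

/-! ### Laurent polynomials and the Witt algebra -/

/-- Laurent polynomials over `K` in the variables `t i`, `i : ι`; the monomial `t ^ n` is
`AddMonoidAlgebra.single n 1`. -/
abbrev Laurent (K ι : Type*) [Field K] : Type _ := AddMonoidAlgebra K (ι → ℤ)

/-- The Witt algebra: all `K`-linear derivations of the algebra of Laurent polynomials,
with the commutator bracket. -/
abbrev Witt (K ι : Type*) [Field K] : Type _ := Derivation K (Laurent K ι) (Laurent K ι)

section Witt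

variable {K ι : Type*} [Field K]

/-- The linear map underlying the degree derivation, `t ^ n ↦ n i • t ^ n`. -/
def degLin (i : ι) : Laurent K ι →ₗ[K] Laurent K ι :=
  Finsupp.lsum K (fun n : ι → ℤ => ((n i : ℤ) : K) • AddMonoidAlgebra.lsingle (R := K) n) ∘ₗ
    (AddMonoidAlgebra.coeffLinearEquiv K).toLinearMap

lemma degLin_single (i : ι) (n : ι → ℤ) (a : K) :
    degLin i (AddMonoidAlgebra.single n a) = AddMonoidAlgebra.single n ((n i : K) * a) := by
  change Finsupp.lsum K (fun n : ι → ℤ => ((n i : ℤ) : K) • AddMonoidAlgebra.lsingle (R := K) n)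
    (AddMonoidAlgebra.single n a).coeff = _
  rw [AddMonoidAlgebra.coeff_single, Finsupp.lsum_single, LinearMap.smul_apply,
    AddMonoidAlgebra.lsingle_apply, AddMonoidAlgebra.smul_single, smul_eq_mul]

/-- The `i`-th degree derivation `d i = t i * ∂ / ∂ t i`. -/
def d (i : ι) : Witt K ι :=
  Derivation.mk' (degLin i) fun f g => by
    induction f using AddMonoidAlgebra.induction_linear with
    | zero => simp
    | add f f' hf hf' => simp only [add_mul, map_add, smul_eq_mul, mul_add] at *; rw [hf, hf']; ring
    | single n a =>
      induction g using AddMonoidAlgebra.induction_linear with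
      | zero => simp
      | add g g' hg hg' =>
        simp only [add_mul, map_add, smul_eq_mul, mul_add] at *; rw [hg, hg']; ring
      | single k b =>
        simp only [AddMonoidAlgebra.single_mul_single, degLin_single, smul_eq_mul]
        rw [add_comm k n, ← AddMonoidAlgebra.single_add]
        congr 1
        push_cast [Pi.add_apply]
        ring

lemma witt_ext {X Y : Witt K ι}
    (h : ∀ n a, X (AddMonoidAlgebra.single n a) = Y (AddMonoidAlgebra.single n a)) : X = Y := by
  ext1 f
  induction f using AddMonoidAlgebra.induction_linear with
  | zero => simp
  | add f g hf hg => rw [map_add, map_add, hf, hg]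
  | single n a => exact h n a

variable [Fintype ι]

/-- The derivation `D(u, r) = ∑ i, u i * t ^ r * d i`. -/
def D (u : ι → K) (r : ι → ℤ) : Witt K ι :=
  ∑ i, AddMonoidAlgebra.single r (u i) • d i

lemma D_single (u : ι → K) (r n : ι → ℤ) (a : K) :
    D u r (AddMonoidAlgebra.single n a)
      = AddMonoidAlgebra.single (r + n) ((u ⬝ᵥ fun i => (n i : K)) * a) := by
  have h : ∀ i, (AddMonoidAlgebra.single r (u i) • d i : Witt K ι) (AddMonoidAlgebra.single n a)
      = AddMonoidAlgebra.single (r + n) (u i * n i * a) := fun i => by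
    have hd : (d i : Witt K ι) (AddMonoidAlgebra.single n a)
        = degLin i (AddMonoidAlgebra.single n a) := rfl
    rw [Derivation.smul_apply, hd, degLin_single, smul_eq_mul,
      AddMonoidAlgebra.single_mul_single, mul_assoc]
  rw [D, ← Derivation.coeFnAddMonoidHom_apply, map_sum, Finset.sum_apply]
  simp only [Derivation.coeFnAddMonoidHom_apply, h, dotProduct, Finset.sum_mul]
  exact (map_sum (AddMonoidAlgebra.singleAddHom (r + n)) _ _).symm

/-- The commutation relations of the Witt algebra. -/
lemma D_lie (u v : ι → K) (r s : ι → ℤ) :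
    ⁅D u r, D v s⁆
      = D ((u ⬝ᵥ fun i => (s i : K)) • v - (v ⬝ᵥ fun i => (r i : K)) • u) (r + s) := by
  refine witt_ext fun n a => ?_
  rw [Derivation.commutator_apply]
  simp only [D_single]
  rw [show s + (r + n) = r + s + n by abel, show r + (s + n) = r + s + n by abel,
    ← AddMonoidAlgebra.single_sub]
  congr 1
  have h1 : ∀ k : ι → ℤ, (fun i => (((k + n) i : ℤ) : K))
      = (fun i => (k i : K)) + fun i => (n i : K) := fun k => by ext; simp
  rw [h1, h1, dotProduct_add, dotProduct_add, sub_dotProduct, smul_dotProduct, smul_dotProduct]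
  simp only [smul_eq_mul]
  ring

lemma D_smul (c : K) (u : ι → K) (r : ι → ℤ) : D (c • u) r = c • D u r := by
  refine witt_ext fun n a => ?_
  rw [Derivation.smul_apply, D_single, D_single, AddMonoidAlgebra.smul_single, smul_dotProduct,
    smul_eq_mul, smul_eq_mul, mul_assoc]

end Witt

/-! ### The Hamiltonian Lie algebra -/

/-- The index set of the `N = 2 m` coordinates: `Sum.inl i` is the coordinate number `i` and
`Sum.inr i` the coordinate number `m + i`. -/
abbrev Idx (m : ℕ) : Type := Fin m ⊕ Fin m

/-- The standard symplectic matrix with blocks `0`, `1`, `-1`, `0`. -/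
def J (m : ℕ) : Matrix (Idx m) (Idx m) ℤ := Matrix.fromBlocks 0 1 (-1) 0

section Hamiltonian

variable (K : Type*) [Field K] {m : ℕ}

/-- The Hamiltonian derivation `h r = D(J r, r)`. -/
def h (r : Idx m → ℤ) : Witt K (Idx m) := D (fun i => ((J m *ᵥ r) i : K)) r

variable {K}

lemma J_dot (r s : Idx m → ℤ) : (J m *ᵥ s) ⬝ᵥ r = -((J m *ᵥ r) ⬝ᵥ s) := by
  have hT : (J m)ᵀ = -J m := by
    simp [J, Matrix.fromBlocks_transpose, Matrix.fromBlocks_neg]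
  rw [dotProduct_comm, Matrix.dotProduct_mulVec, ← Matrix.mulVec_transpose, hT,
    Matrix.neg_mulVec, neg_dotProduct]

lemma cast_dot (r s : Idx m → ℤ) :
    ((fun i => (r i : K)) ⬝ᵥ fun i => (s i : K)) = ((r ⬝ᵥ s : ℤ) : K) := by
  simp [dotProduct]

lemma h_lie (r s : Idx m → ℤ) : ⁅h K r, h K s⁆ = (((J m *ᵥ r) ⬝ᵥ s : ℤ) : K) • h K (r + s) := by
  rw [h, h, h, D_lie, ← D_smul, cast_dot, cast_dot, J_dot r s]
  congr 1
  ext i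
  simp [Matrix.mulVec_add]
  ring

lemma D_zero_h (u : Idx m → K) (s : Idx m → ℤ) :
    ⁅D u 0, h K s⁆ = (u ⬝ᵥ fun i => (s i : K)) • h K s := by
  rw [h, D_lie, ← D_smul, zero_add]
  congr 1
  ext i
  simp [dotProduct]

lemma D_zero_D_zero (u v : Idx m → K) : ⁅D u 0, D v 0⁆ = 0 := by
  rw [D_lie]
  refine witt_ext fun n a => ?_
  rw [D_single]
  simp [dotProduct]

variable (K) (m)

/-- The Hamiltonian Lie algebra `H_N`, `N = 2 m`, on the torus: the linear span of all `h r`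
together with the Cartan subalgebra of all `D(u, 0)`, as a Lie subalgebra of the Witt algebra. -/
def hamiltonian : LieSubalgebra K (Witt K (Idx m)) where
  toSubmodule := Submodule.span K
    (Set.range (fun r : Idx m → ℤ => h K r) ∪ Set.range fun u : Idx m → K => D u 0)
  lie_mem' := by
    intro x y hx hy
    change ⁅x, y⁆ ∈ Submodule.span K _
    refine Submodule.span_induction₂ (p := fun x y _ _ => ⁅x, y⁆ ∈ Submodule.span K
      (Set.range (fun r : Idx m → ℤ => h K r) ∪ Set.range fun u : Idx m → K => D u 0))
      ?_ ?_ ?_ ?_ ?_ ?_ ?_ hx hy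
    · rintro _ _ (⟨r, rfl⟩ | ⟨u, rfl⟩) (⟨s, rfl⟩ | ⟨v, rfl⟩)
      · change ⁅h K r, h K s⁆ ∈ _
        rw [h_lie]
        exact Submodule.smul_mem _ _ (Submodule.subset_span (Or.inl ⟨_, rfl⟩))
      · change ⁅h K r, D v 0⁆ ∈ _
        rw [← lie_skew, D_zero_h]
        exact neg_mem (Submodule.smul_mem _ _ (Submodule.subset_span (Or.inl ⟨_, rfl⟩)))
      · change ⁅D u 0, h K s⁆ ∈ _
        rw [D_zero_h]
        exact Submodule.smul_mem _ _ (Submodule.subset_span (Or.inl ⟨_, rfl⟩))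
      · change ⁅D u 0, D v 0⁆ ∈ _
        rw [D_zero_D_zero]
        exact zero_mem _
    · intro y _
      have e : ⁅(0 : Witt K (Idx m)), y⁆ = 0 := zero_lie y
      rw [e]; exact zero_mem _
    · intro x _
      have e : ⁅x, (0 : Witt K (Idx m))⁆ = 0 := lie_zero x
      rw [e]; exact zero_mem _
    · intro x y z _ _ _ h1 h2
      have e : ⁅x + y, z⁆ = ⁅x, z⁆ + ⁅y, z⁆ := add_lie x y z
      rw [e]; exact add_mem h1 h2
    · intro x y z _ _ _ h1 h2
      have e : ⁅x, y + z⁆ = ⁅x, y⁆ + ⁅x, z⁆ := lie_add x y z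
      rw [e]; exact add_mem h1 h2
    · intro c x y _ _ h1
      have e : ⁅c • x, y⁆ = c • ⁅x, y⁆ := smul_lie c x y
      rw [e]; exact Submodule.smul_mem _ _ h1
    · intro c x y _ _ h1
      have e : ⁅x, c • y⁆ = c • ⁅x, y⁆ := lie_smul c x y
      rw [e]; exact Submodule.smul_mem _ _ h1

/-- The derived subalgebra `H_N' = [H_N, H_N]`. -/
abbrev derived : LieIdeal K (hamiltonian K m) :=
  ⁅(⊤ : LieIdeal K (hamiltonian K m)), (⊤ : LieIdeal K (hamiltonian K m))⁆

variable {m}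

lemma h_mem (r : Idx m → ℤ) : h K r ∈ hamiltonian K m :=
  Submodule.subset_span (Or.inl ⟨r, rfl⟩)

lemma D_zero_mem (u : Idx m → K) : D u 0 ∈ hamiltonian K m :=
  Submodule.subset_span (Or.inr ⟨u, rfl⟩)

lemma h_zero : h K (0 : Idx m → ℤ) = 0 := by
  refine witt_ext fun n a => ?_
  rw [h, D_single]
  simp [dotProduct]

lemma h_mem_derived [CharZero K] (r : Idx m → ℤ) :
    (⟨h K r, h_mem K r⟩ : hamiltonian K m) ∈ derived K m := by
  by_cases hr : r = 0
  · subst hr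
    rw [show (⟨h K 0, h_mem K 0⟩ : hamiltonian K m) = 0 from Subtype.ext (h_zero K)]
    exact zero_mem _
  · obtain ⟨i, hi⟩ := Function.ne_iff.mp hr
    have hi' : (r i : K) ≠ 0 := by exact_mod_cast hi
    have key : (⟨h K r, h_mem K r⟩ : hamiltonian K m)
        = ⁅(⟨D (Pi.single i (r i : K)⁻¹) 0, D_zero_mem K _⟩ : hamiltonian K m),
            (⟨h K r, h_mem K r⟩ : hamiltonian K m)⁆ := by
      refine Subtype.ext ?_
      change h K r = ⁅D (Pi.single i (r i : K)⁻¹) 0, h K r⁆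
      rw [D_zero_h, single_dotProduct, inv_mul_cancel₀ hi', one_smul]
    rw [key]
    exact LieSubmodule.lie_mem_lie (LieSubmodule.mem_top _) (LieSubmodule.mem_top _)

/-- The element `h r` of the derived subalgebra. -/
def hElt [CharZero K] (r : Idx m → ℤ) : derived K m := ⟨⟨h K r, h_mem K r⟩, h_mem_derived K r⟩

end Hamiltonian

/-! ### The conformal symplectic group, the torus and their semidirect product -/

/-- The integral conformal symplectic group: integral invertible matrices `Q` with
`Qᵀ J Q = c J` for some `c = ± 1`. -/
def GSp (m : ℕ) : Subgroup (GL (Idx m) ℤ) where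
  carrier := {Q | ∃ c : ℤˣ, (Q : Matrix (Idx m) (Idx m) ℤ)ᵀ * J m * Q = (c : ℤ) • J m}
  one_mem' := ⟨1, by simp⟩
  mul_mem' := by
    rintro P Q ⟨c, hP⟩ ⟨e, hQ⟩
    refine ⟨c * e, ?_⟩
    rw [Units.val_mul, Matrix.transpose_mul,
      show (Q : Matrix (Idx m) (Idx m) ℤ)ᵀ * (P : Matrix (Idx m) (Idx m) ℤ)ᵀ * J m * (P * Q)
        = (Q : Matrix (Idx m) (Idx m) ℤ)ᵀ * ((P : Matrix (Idx m) (Idx m) ℤ)ᵀ * J m * P) * Q by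
          simp only [Matrix.mul_assoc], hP, Matrix.mul_smul, Matrix.smul_mul, hQ, smul_smul,
      Units.val_mul]
  inv_mem' := by
    rintro Q ⟨c, hQ⟩
    refine ⟨c⁻¹, ?_⟩
    have h1 : (Q : Matrix (Idx m) (Idx m) ℤ) * (Q⁻¹ : GL (Idx m) ℤ) = 1 := Q.mul_inv
    have h2 : ((Q⁻¹ : GL (Idx m) ℤ) : Matrix (Idx m) (Idx m) ℤ)ᵀ
        * (Q : Matrix (Idx m) (Idx m) ℤ)ᵀ = 1 := by
      rw [← Matrix.transpose_mul, h1, Matrix.transpose_one]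
    have h3 : J m = (c : ℤ) • (((Q⁻¹ : GL (Idx m) ℤ) : Matrix (Idx m) (Idx m) ℤ)ᵀ * J m
        * (Q⁻¹ : GL (Idx m) ℤ)) := by
      rw [← Matrix.smul_mul, ← Matrix.mul_smul, ← hQ]
      calc J m = (((Q⁻¹ : GL (Idx m) ℤ) : Matrix (Idx m) (Idx m) ℤ)ᵀ
            * (Q : Matrix (Idx m) (Idx m) ℤ)ᵀ) * J m
            * ((Q : Matrix (Idx m) (Idx m) ℤ) * (Q⁻¹ : GL (Idx m) ℤ)) := by rw [h1, h2]; simp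
        _ = _ := by simp only [Matrix.mul_assoc]
    conv_rhs => rw [h3]
    rw [smul_smul, ← Units.val_mul, inv_mul_cancel, Units.val_one, one_smul]

/-- The torus `(Kˣ) ^ N`, with componentwise multiplication. -/
abbrev Torus (K : Type*) [Field K] (m : ℕ) : Type _ := Idx m → Kˣ

section Torus

variable {K : Type*} [Field K] {m : ℕ}

/-- The monomial `l ^ r = ∏ i, l i ^ r i` of a torus element. -/
def tpow (l : Torus K m) (r : Idx m → ℤ) : Kˣ := ∏ i, l i ^ r i

/-- The torus element `A * l` whose `i`-th coordinate is `l ^ (A⁻¹ e_i)`; equivalently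
`(A * l) ^ r = l ^ (A⁻¹ r)` for all `r`. -/
def actFun (A : GL (Idx m) ℤ) (l : Torus K m) : Torus K m :=
  fun i => tpow l ((A⁻¹ : GL (Idx m) ℤ).val.col i)

lemma tpow_actFun (A : GL (Idx m) ℤ) (l : Torus K m) (r : Idx m → ℤ) :
    tpow (actFun A l) r = tpow l ((A⁻¹ : GL (Idx m) ℤ).val *ᵥ r) := by
  have hsum : ∀ (x : Kˣ) (f : Idx m → ℤ), x ^ (∑ i, f i) = ∏ i, x ^ f i := fun x f =>
    map_sum (zmultiplesHom (Additive Kˣ) (Additive.ofMul x)) f Finset.univ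
  simp only [tpow, actFun, Matrix.mulVec, dotProduct, hsum, ← Finset.prod_zpow, zpow_mul,
    Matrix.col_apply]
  rw [Finset.prod_comm]

lemma torus_ext {l l' : Torus K m} (hl : ∀ r, tpow l r = tpow l' r) : l = l' := by
  funext i
  have := hl (Pi.single i 1)
  simpa [tpow, Pi.single_apply, Finset.prod_ite_eq, apply_ite (fun n : ℤ => _ ^ n)] using this

lemma tpow_mul (l l' : Torus K m) (r : Idx m → ℤ) : tpow (l * l') r = tpow l r * tpow l' r := by
  simp [tpow, mul_zpow, Finset.prod_mul_distrib]

lemma actFun_mul (A B : GL (Idx m) ℤ) (l : Torus K m) :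
    actFun (A * B) l = actFun A (actFun B l) := by
  refine torus_ext fun r => ?_
  rw [tpow_actFun, tpow_actFun, tpow_actFun, mul_inv_rev, Units.val_mul, Matrix.mulVec_mulVec]

lemma actFun_one (l : Torus K m) : actFun 1 l = l := by
  refine torus_ext fun r => ?_
  rw [tpow_actFun, inv_one, Units.val_one, Matrix.one_mulVec]

lemma actFun_map_mul (A : GL (Idx m) ℤ) (l l' : Torus K m) :
    actFun A (l * l') = actFun A l * actFun A l' := by
  refine torus_ext fun r => ?_
  rw [tpow_actFun, tpow_mul, tpow_mul, tpow_actFun, tpow_actFun]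

variable (K m)

/-- The action of the conformal symplectic group on the torus by automorphisms,
characterized by `(Q * l) ^ r = l ^ (Q⁻¹ r)`. -/
def act : GSp m →* MulAut (Torus K m) where
  toFun Q :=
    { toFun := actFun (Q : GL (Idx m) ℤ)
      invFun := actFun (Q⁻¹ : GL (Idx m) ℤ)
      left_inv := fun l => by rw [← actFun_mul, inv_mul_cancel, actFun_one]
      right_inv := fun l => by rw [← actFun_mul, mul_inv_cancel, actFun_one]
      map_mul' := actFun_map_mul _ }
  map_one' := MulEquiv.ext fun l => actFun_one l
  map_mul' P Q := MulEquiv.ext fun l => actFun_mul _ _ l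

end Torus

/-- The automorphism `s` of `H_N'` is the one given by the conformal symplectic matrix `Q` and the
torus element `l`:  `s (h r) = l ^ r h (Q r)` if `Qᵀ J Q = J`, and
`s (h r) = - (-1) ^ |r| l ^ r h (Q r)` with `|r| = ∑ i, r i` if `Qᵀ J Q = - J`. -/
def IsGivenBy {K : Type*} [Field K] [CharZero K] {m : ℕ} (s : LieAut K (derived K m))
    (Q : GSp m) (l : Torus K m) : Prop :=
  ((Q.1.val)ᵀ * J m * Q.1.val = J m →
    ∀ r : Idx m → ℤ, r ≠ 0 → s (hElt K r) = (tpow l r : K) • hElt K (Q.1.val *ᵥ r)) ∧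
  ((Q.1.val)ᵀ * J m * Q.1.val = -J m →
    ∀ r : Idx m → ℤ, r ≠ 0 →
      s (hElt K r) = (-(-1 : K) ^ (∑ i, r i) * (tpow l r : K)) • hElt K (Q.1.val *ᵥ r))

end

end TorusHamiltonian

/-! The degree derivations `D u 0` act on `H_N'` with one-dimensional common eigenspaces, the lines
through the `h r`, so it suffices that an automorphism `σ` respects this grading. Conjugating `ad
D(u, 0)` by `σ` gives a derivation `δ`. The component of `δ` of degree `r ≠ 0` is a multiple `c r`
of `ad (h r)` (`exists_eq_mul_omega`), and only finitely many `c r` are nonzero. If one is, choose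
`r` extremal for a generic functional and `s` with `omega r s ≠ 0`: then `δ ^ n` sends `h s` to an
element with leading term at `s + n r`. But all iterates of `δ` on `h s` stay in one
finite-dimensional graded subspace, because `ad D(u, 0)` never enlarges supports. Hence `δ` is
diagonal (`co_eq_zero_of_locallyFinite`), and `σ (h s)` is a common eigenvector, thus a multiple `a
s` of some `h (q s)`. Eigenvalues add, so `q` is linear.

Comparing brackets, `omega (q s) (q t)` vanishes whenever `omega s t` does, which forces it to be `c
* omega s t` (`eq_smul_omega`); the same for the inverse gives `c = ± 1`. Then `c * a` is
multiplicative on non-orthogonal pairs, hence a character of the lattice, that is, a point of the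
torus. Conversely such monomial maps preserve brackets because `c ^ 2 = 1`. The factor `-(-1) ^ |r|`
in the second description is `c` times a character, so it only translates the torus parameter. -/

namespace TorusHamiltonian

noncomputable section

/-! ### The symplectic form on the lattice and its cocycle equation. -/

section Omega

variable {m : ℕ}

/-- The symplectic form `(J r) ⬝ s` on the lattice. -/
def omega (m : ℕ) : (Idx m → ℤ) →ₗ[ℤ] (Idx m → ℤ) →ₗ[ℤ] ℤ :=
  LinearMap.mk₂ ℤ (fun r s => (J m *ᵥ r) ⬝ᵥ s)
    (fun _ _ _ => by rw [Matrix.mulVec_add, add_dotProduct])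
    (fun _ _ _ => by rw [Matrix.mulVec_smul, smul_dotProduct])
    (fun _ _ _ => by rw [dotProduct_add])
    (fun _ _ _ => by rw [dotProduct_smul])

lemma omega_apply (r s : Idx m → ℤ) : omega m r s = (J m *ᵥ r) ⬝ᵥ s := rfl

lemma omega_swap (r s : Idx m → ℤ) : omega m s r = -omega m r s := J_dot r s

@[simp] lemma omega_self (r : Idx m → ℤ) : omega m r r = 0 := by
  have := omega_swap r r
  omega

lemma J_mul_J : J m * J m = -1 := by
  rw [J, Matrix.fromBlocks_multiply, ← Matrix.fromBlocks_one, Matrix.fromBlocks_neg]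
  simp

lemma J_mulVec_ne_zero {v : Idx m → ℤ} (hv : v ≠ 0) : J m *ᵥ v ≠ 0 := by
  intro h0
  apply hv
  have : J m *ᵥ (J m *ᵥ v) = -v := by
    rw [Matrix.mulVec_mulVec, J_mul_J, Matrix.neg_mulVec, Matrix.one_mulVec]
  rw [h0, Matrix.mulVec_zero] at this
  exact neg_eq_zero.mp this.symm

/-- A functional not vanishing on any of finitely many nonzero lattice vectors. -/
lemma exists_dotProduct_ne_zero {ι : Type*} [Fintype ι] [DecidableEq ι] (S : Finset (ι → ℤ))
    (hS : ∀ v ∈ S, v ≠ 0) : ∃ p : ι → ℤ, ∀ v ∈ S, v ⬝ᵥ p ≠ 0 := by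
  classical
  induction S using Finset.induction_on with
  | empty => exact ⟨0, by simp⟩
  | insert v S hv ih =>
    obtain ⟨p, hp⟩ := ih fun w hw => hS w (Finset.mem_insert_of_mem hw)
    by_cases h0 : v ⬝ᵥ p = 0
    · obtain ⟨i, hi⟩ := Function.ne_iff.mp (hS v (Finset.mem_insert_self _ _))
      let w : ι → ℤ := Pi.single i 1
      let k : ℤ := 1 + ∑ s ∈ S, |s ⬝ᵥ w|
      -- `w` repairs the vanishing at `v`; `k` exceeds every `|s ⬝ w|`, so the nonzero integers `s ⬝
      -- p` still dominate on the old vectors.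
      refine ⟨k • p + w, fun s hs => ?_⟩
      rw [dotProduct_add, dotProduct_smul, smul_eq_mul]
      rcases Finset.mem_insert.mp hs with rfl | hs
      · simpa [h0, w] using hi
      · have h1 : |s ⬝ᵥ w| ≤ ∑ s ∈ S, |s ⬝ᵥ w| :=
          Finset.single_le_sum (f := fun s => |s ⬝ᵥ w|) (fun _ _ => abs_nonneg _) hs
        have h2 : 1 ≤ |s ⬝ᵥ p| := Int.one_le_abs (hp s hs)
        intro h3
        have h4 : |s ⬝ᵥ w| = k * |s ⬝ᵥ p| := by
          have hk : |k| = k := abs_of_nonneg (by positivity)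
          rw [← hk, ← abs_mul, eq_neg_of_add_eq_zero_left h3, abs_neg]
        have hk : 0 ≤ k := by positivity
        have h5 : k ≤ k * |s ⬝ᵥ p| := le_mul_of_one_le_right hk h2
        have h6 : k = 1 + ∑ s ∈ S, |s ⬝ᵥ w| := rfl
        omega
    · exact ⟨p, fun s hs => by
        rcases Finset.mem_insert.mp hs with rfl | hs
        exacts [h0, hp s hs]⟩

lemma exists_omega_ne_zero (S : Finset (Idx m → ℤ)) (hS : ∀ v ∈ S, v ≠ 0) :
    ∃ p, ∀ v ∈ S, omega m v p ≠ 0 := by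
  classical
  obtain ⟨p, hp⟩ := exists_dotProduct_ne_zero (S.image fun v => J m *ᵥ v) (by
    intro v hv
    obtain ⟨w, hw, rfl⟩ := Finset.mem_image.mp hv
    exact J_mulVec_ne_zero (hS w hw))
  exact ⟨p, fun v hv => hp _ (Finset.mem_image_of_mem _ hv)⟩

lemma exists_omega_ne_zero_one {v : Idx m → ℤ} (hv : v ≠ 0) : ∃ p, omega m v p ≠ 0 := by
  obtain ⟨p, hp⟩ := exists_omega_ne_zero {v} (by simpa using hv)
  exact ⟨p, hp v (by simp)⟩

/-- A function on the lattice which is additive on pairs of non-orthogonal vectors is additive. -/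
lemma map_add_of_omega_ne_zero {A : Type*} [AddCommGroup A] {f : (Idx m → ℤ) → A} (h0 : f 0 = 0)
    (hf : ∀ s t, omega m s t ≠ 0 → f (s + t) = f s + f t) (s t : Idx m → ℤ) :
    f (s + t) = f s + f t := by
  classical
  by_cases hs : s = 0
  · simp [hs, h0]
  by_cases ht : t = 0
  · simp [ht, h0]
  by_cases hω : omega m s t = 0
  swap
  · exact hf s t hω
  by_cases hst : s + t = 0
  -- Here `t = -s`: adding first `s` and then `t` to `p` returns to `p`, so `f s + f t = 0`.
  · obtain ⟨p, hp⟩ := exists_omega_ne_zero_one hs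
    have h1 := hf s p hp
    have h2 := hf t (s + p) (by
      rw [map_add, omega_swap s t, hω, eq_neg_of_add_eq_zero_right hst]; simpa using hp)
    rw [← add_assoc, add_comm t s, hst, zero_add, h1] at h2
    rw [hst, h0]
    have : f p + 0 = f p + (f s + f t) := by rw [add_zero]; nth_rw 1 [h2]; abel
    exact add_left_cancel this
  -- Expand `f (s + t + p)` in two ways; every pair that occurs is non-orthogonal, since `omega s (t
  -- + p) = omega s p`.
  · obtain ⟨p, hp⟩ := exists_omega_ne_zero {s, t, s + t} (by simp [hs, ht, hst])
    have h1 := hf (s + t) p (hp _ (by simp))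
    have h2 := hf t p (hp _ (by simp))
    have h3 := hf s (t + p) (by rw [map_add, hω, zero_add]; exact hp _ (by simp))
    rw [add_assoc, h3, h2, ← add_assoc] at h1
    exact (add_right_cancel h1).symm

/-- The cocycle equation for a homogeneous derivation of nonzero degree `r` only has the inner
solutions. -/
lemma exists_eq_mul_omega {K : Type*} [Field K] [CharZero K] {r : Idx m → ℤ} (hr : r ≠ 0)
    {f : (Idx m → ℤ) → K} (hr0 : f (-r) = 0)
    (hf : ∀ s t, (omega m s t : K) * f (s + t)
      = (omega m (s + r) t : K) * f s + (omega m s (t + r) : K) * f t) :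
    ∃ c : K, ∀ s, f s = c * (omega m r s : K) := by
  classical
  -- Periodicity along `r`: the cocycle equation at `(-r, t + r)`, where the term with `f (-r)`
  -- drops out.
  have hper : ∀ t, omega m r t ≠ 0 → f (t + r) = f t := by
    intro t ht
    have h1 := hf (-r) (t + r)
    have h2 : (omega m r t : K) ≠ 0 := by exact_mod_cast ht
    rw [hr0] at h1
    simp only [map_neg, LinearMap.neg_apply, map_add, omega_self, neg_zero, add_zero,
      Int.cast_neg, neg_add_cancel_comm_assoc, mul_zero, zero_add] at h1
    exact (mul_left_cancel₀ (neg_ne_zero.mpr h2) h1).symm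
  -- By periodicity, the equations at `(s, t)` and `(s + r, t)` differ by `omega r t` times the
  -- defect of additivity. So `f (s + t) = f s + f t`, and substituting this back leaves the
  -- proportionality.
  have hprop : ∀ s t, omega m r s ≠ 0 → omega m r t ≠ 0 → omega m r (s + t) ≠ 0 →
      f s * (omega m r t : K) = f t * (omega m r s : K) := by
    intro s t hs ht hst
    have h1 := hf s t
    have h2 := hf (s + r) t
    have h3 : (omega m r t : K) ≠ 0 := by exact_mod_cast ht
    rw [show s + r + t = (s + t) + r by abel, hper _ hst, hper _ hs] at h2
    simp only [map_add, LinearMap.add_apply, Int.cast_add, omega_self, omega_swap r s,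
      Int.cast_neg, Int.cast_zero] at h1 h2
    have h4 : (omega m r t : K) * (f (s + t) - f s - f t) = 0 := by linear_combination h2 - h1
    have h5 := (mul_eq_zero.mp h4).resolve_left h3
    linear_combination (omega m s t : K) * h5 - h1
  obtain ⟨p, hp⟩ := exists_omega_ne_zero_one hr
  have hpK : (omega m r p : K) ≠ 0 := by exact_mod_cast hp
  have h2p : omega m r (p + p) ≠ 0 := by rw [map_add]; omega
  have hc : ∀ s, omega m r s ≠ 0 → f s = f p / (omega m r p : K) * (omega m r s : K) := by
    intro s hs
    -- If `s + p` is orthogonal to `r`, compare through `p + p` instead: `omega r (s + 2 p) = omega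
    -- r p ≠ 0`.
    by_cases hsp : omega m r (s + p) = 0
    · have h1 := hprop s (p + p) hs h2p (by rw [map_add, map_add] at *; omega)
      have h2 := hprop p (p + p) hp h2p (by rw [map_add, map_add] at *; omega)
      rw [map_add, Int.cast_add] at h1 h2
      rw [div_mul_eq_mul_div, eq_div_iff hpK]
      have h3 : (2 * (omega m r p : K)) * (f s * (omega m r p : K)) =
        (2 * (omega m r p : K)) * (f p * (omega m r s : K)) := by
          linear_combination (omega m r p : K) * h1 - (omega m r s : K) * h2
      exact mul_left_cancel₀ (mul_ne_zero two_ne_zero hpK) h3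
    · rw [div_mul_eq_mul_div, eq_div_iff hpK]
      exact hprop s p hs hp hsp
  refine ⟨f p / (omega m r p : K), fun s => ?_⟩
  by_cases hs : omega m r s = 0
  swap
  · exact hc s hs
  rw [hs, Int.cast_zero, mul_zero]
  by_cases hsr : s + r = 0
  · rw [eq_neg_of_add_eq_zero_left hsr, hr0]
  -- With `s` orthogonal to `r`, both `f t` and `f (s + t)` are already known; they cancel in the
  -- equation at `(s, t)`, leaving `omega (s + r) t * f s = 0`.
  obtain ⟨t, ht⟩ := exists_omega_ne_zero {r, s + r} (by simp [hr, hsr])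
  have h1 := ht r (by simp)
  have h2 : (omega m (s + r) t : K) ≠ 0 := by exact_mod_cast ht (s + r) (by simp)
  have h3 := hf s t
  rw [hc (s + t) (by rwa [map_add, hs, zero_add]), hc t h1, map_add (omega m r),
    map_add (omega m s) t r, omega_swap r s, hs, neg_zero, add_zero, zero_add] at h3
  have h4 : (omega m (s + r) t : K) * f s = 0 := by linear_combination -h3
  exact (mul_eq_zero.mp h4).resolve_left h2

end Omega

/-! ### A basis of the derived algebra and its coefficient functionals. -/

section Coefficients

variable {K : Type*} [Field K] {m : ℕ}

/-- Brackets of generators are multiples of some `h r`, and `h 0 = 0`, so nothing of degree zero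
survives. -/
lemma derived_le_span :
    ∀ x ∈ derived K m, (x : Witt K (Idx m)) ∈
      Submodule.span K (Set.range fun r : {r : Idx m → ℤ // r ≠ 0} => h K r.1) := by
  have hs : ∀ (c : K) (r : Idx m → ℤ), c • h K r ∈
      Submodule.span K (Set.range fun r : {r : Idx m → ℤ // r ≠ 0} => h K r.1) := by
    intro c r
    apply Submodule.smul_mem
    by_cases hr : r = 0
    · rw [hr, h_zero]; exact zero_mem _
    · exact Submodule.subset_span ⟨⟨r, hr⟩, rfl⟩
  have key : ∀ x ∈ hamiltonian K m, ∀ y ∈ hamiltonian K m, ⁅x, y⁆ ∈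
      Submodule.span K (Set.range fun r : {r : Idx m → ℤ // r ≠ 0} => h K r.1) := by
    intro x hx y hy
    refine Submodule.span_induction₂ (p := fun x y _ _ => ⁅x, y⁆ ∈
      Submodule.span K (Set.range fun r : {r : Idx m → ℤ // r ≠ 0} => h K r.1))
      ?_ ?_ ?_ ?_ ?_ ?_ ?_ hx hy
    · rintro _ _ (⟨r, rfl⟩ | ⟨u, rfl⟩) (⟨s, rfl⟩ | ⟨v, rfl⟩)
      · exact h_lie (K := K) r s ▸ hs _ _
      · change ⁅h K r, D v 0⁆ ∈ _
        rw [← lie_skew, D_zero_h]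
        exact neg_mem (hs _ _)
      · exact D_zero_h u s ▸ hs _ _
      · exact D_zero_D_zero u v ▸ zero_mem _
    · intro y _
      have e : ⁅(0 : Witt K (Idx m)), y⁆ = 0 := zero_lie y
      rw [e]
      exact zero_mem _
    · intro x _
      have e : ⁅x, (0 : Witt K (Idx m))⁆ = 0 := lie_zero x
      rw [e]
      exact zero_mem _
    · intro x y z _ _ _ h1 h2
      exact (add_lie x y z).symm ▸ add_mem h1 h2
    · intro x y z _ _ _ h1 h2
      exact (lie_add x y z).symm ▸ add_mem h1 h2
    · intro c x y _ _ h1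
      exact (smul_lie c x y).symm ▸ Submodule.smul_mem _ _ h1
    · intro c x y _ _ h1
      exact (lie_smul c x y).symm ▸ Submodule.smul_mem _ _ h1
  have hle : LieSubmodule.toSubmodule (derived K m) ≤
      (Submodule.span K (Set.range fun r : {r : Idx m → ℤ // r ≠ 0} => h K r.1)).comap
        (hamiltonian K m).toSubmodule.subtype := by
    rw [LieSubmodule.lieIdeal_oper_eq_linear_span', Submodule.span_le]
    rintro _ ⟨x, -, y, -, rfl⟩
    exact key x x.2 y y.2
  exact fun x hx => hle hx

variable [CharZero K]

lemma hElt_zero : hElt K (0 : Idx m → ℤ) = 0 := Subtype.ext (Subtype.ext (h_zero K))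

lemma hElt_lie (r s : Idx m → ℤ) :
    ⁅hElt K r, hElt K s⁆ = (omega m r s : K) • hElt K (r + s) :=
  Subtype.ext (Subtype.ext (h_lie r s))

/-- Apply a relation to `t ^ n` with `omega r n ≠ 0`: the terms land in distinct degrees `i + n`,
and the one for `r` has the nonzero factor `omega r n`. -/
lemma linearIndependent_h :
    LinearIndependent K fun r : {r : Idx m → ℤ // r ≠ 0} => h K r.1 := by
  classical
  rw [linearIndependent_iff']
  intro S g hg r hr
  obtain ⟨n, hn⟩ := exists_omega_ne_zero_one r.2
  have h1 : (∑ i ∈ S, g i • h K i.1) (AddMonoidAlgebra.single n 1) = 0 := by rw [hg]; rfl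
  rw [← Derivation.coeFnAddMonoidHom_apply, map_sum, Finset.sum_apply] at h1
  have h2 := congrArg (fun x : Laurent K (Idx m) => x.coeff (r.1 + n)) h1
  have h3 : ∀ i : {r : Idx m → ℤ // r ≠ 0},
      (Derivation.coeFnAddMonoidHom (g i • h K i.1) (AddMonoidAlgebra.single n (1 : K))).coeff
        (r.1 + n) = if i = r then g r * (omega m r.1 n : K) else 0 := by
    intro i
    rw [Derivation.coeFnAddMonoidHom_apply, Derivation.smul_apply, h, D_single, cast_dot]
    by_cases hir : i = r
    · subst hir
      simp [omega_apply]
    · have : i.1 + n ≠ r.1 + n := fun e => hir (Subtype.ext (add_right_cancel e))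
      simp [hir, this]
  simp only [AddMonoidAlgebra.coeff_sum, Finsupp.finsetSum_apply, h3, Finset.sum_ite_eq', hr,
    if_true, AddMonoidAlgebra.coeff_zero, Finsupp.zero_apply] at h2
  exact (mul_eq_zero.mp h2).resolve_right (by exact_mod_cast hn)

variable (K m) in
/-- The basis of `H_N'` formed by the `h r`, `r ≠ 0`. -/
def hBasis : Module.Basis {r : Idx m → ℤ // r ≠ 0} K (derived K m) :=
  let ψ : derived K m →ₗ[K] Witt K (Idx m) :=
    (hamiltonian K m).toSubmodule.subtype ∘ₗ (derived K m).toSubmodule.subtype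
  have hψ : Function.Injective ψ := fun _ _ e => Subtype.ext (Subtype.ext e)
  Module.Basis.mk (v := fun r => hElt K r.1)
    (LinearIndependent.of_comp ψ (linearIndependent_h (K := K) (m := m)))
    (by
      intro x _
      have h1 : ψ x ∈ Submodule.span K (Set.range fun r : {r : Idx m → ℤ // r ≠ 0} => h K r.1) :=
        derived_le_span x.1 x.2
      have h2 : (Set.range fun r : {r : Idx m → ℤ // r ≠ 0} => h K r.1)
          = ψ '' Set.range (fun r : {r : Idx m → ℤ // r ≠ 0} => hElt K r.1) := by
        rw [← Set.range_comp]; rfl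
      rw [h2, ← Submodule.map_span] at h1
      obtain ⟨y, hy, e⟩ := h1
      exact hψ e ▸ hy)

@[simp] lemma hBasis_apply (r : {r : Idx m → ℤ // r ≠ 0}) : hBasis K m r = hElt K r.1 := by
  simp [hBasis]

/-- The coefficients of an element of `H_N'` with respect to the `h r`. -/
def co : derived K m →ₗ[K] (Idx m → ℤ) →₀ K :=
  Finsupp.lmapDomain K K (Subtype.val : {r : Idx m → ℤ // r ≠ 0} → Idx m → ℤ) ∘ₗ
    (hBasis K m).repr.toLinearMap

lemma co_hElt {r : Idx m → ℤ} (hr : r ≠ 0) : co (hElt K r) = Finsupp.single r 1 := by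
  have : hElt K r = hBasis K m ⟨r, hr⟩ := by simp
  rw [this, co, LinearMap.comp_apply, LinearEquiv.coe_coe, Module.Basis.repr_self,
    Finsupp.lmapDomain_apply, Finsupp.mapDomain_single]

lemma co_injective : Function.Injective (co : derived K m → (Idx m → ℤ) →₀ K) :=
  (Finsupp.mapDomain_injective Subtype.val_injective).comp (hBasis K m).repr.injective

lemma linearMap_ext_hElt {M : Type*} [AddCommGroup M] [Module K M] {f g : derived K m →ₗ[K] M}
    (hfg : ∀ r, r ≠ 0 → f (hElt K r) = g (hElt K r)) : f = g :=
  (hBasis K m).ext fun r => by simpa using hfg r.1 r.2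

lemma co_apply_zero (x : derived K m) : co x 0 = 0 := by
  have : (Finsupp.lapply 0 : ((Idx m → ℤ) →₀ K) →ₗ[K] K) ∘ₗ co = 0 :=
    linearMap_ext_hElt fun r hr => by simp [co_hElt hr, hr]
  exact LinearMap.congr_fun this x

lemma eq_sum_co (x : derived K m) : x = (co x).sum fun s a => a • hElt K s := by
  have : LinearMap.id = Finsupp.lsum K (fun s => LinearMap.toSpanSingleton K _ (hElt K s)) ∘ₗ
      (co : derived K m →ₗ[K] _) :=
    linearMap_ext_hElt fun r hr => by simp [co_hElt hr]
  exact LinearMap.congr_fun this x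

lemma hElt_ne_zero {r : Idx m → ℤ} (hr : r ≠ 0) : hElt K r ≠ 0 := by
  intro e
  have := co_hElt (K := K) hr
  rw [e, map_zero] at this
  simpa using DFunLike.congr_fun this r

lemma smul_hElt_eq {a b : K} {r s : Idx m → ℤ} (hr : r ≠ 0) (hs : s ≠ 0) (ha : a ≠ 0)
    (e : a • hElt K r = b • hElt K s) : r = s ∧ a = b := by
  have h1 := congrArg (fun x => co x r) e
  simp only [map_smul, co_hElt hr, co_hElt hs, Finsupp.smul_apply, Finsupp.single_eq_same,
    smul_eq_mul, mul_one] at h1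
  by_cases hrs : s = r
  · subst hrs
    simpa using h1
  · rw [Finsupp.single_eq_of_ne (Ne.symm hrs), mul_zero] at h1
    exact absurd h1 ha

lemma co_hElt_lie (r : Idx m → ℤ) (x : derived K m) (s : Idx m → ℤ) :
    co ⁅hElt K r, x⁆ s = (omega m r s : K) * co x (s - r) := by
  have : (Finsupp.lapply s : ((Idx m → ℤ) →₀ K) →ₗ[K] K) ∘ₗ co ∘ₗ
      (LieAlgebra.ad K (derived K m) (hElt K r) : derived K m →ₗ[K] derived K m)
      = (omega m r s : K) • (Finsupp.lapply (s - r) ∘ₗ co) := by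
    refine linearMap_ext_hElt fun t ht => ?_
    simp only [LinearMap.comp_apply, LieAlgebra.ad_apply, hElt_lie, map_smul, LinearMap.smul_apply,
      Finsupp.lapply_apply, co_hElt ht, smul_eq_mul]
    by_cases hrt : r + t = 0
    · have e : t = -r := eq_neg_of_add_eq_zero_right hrt
      subst e
      rw [hrt, hElt_zero, map_zero]
      by_cases hs : s = 0
      · simp [hs]
      · have : s - r ≠ -r := fun e => hs (by simpa [sub_eq_add_neg] using e)
        simp [this]
    · rw [co_hElt hrt]
      by_cases hs : s = r + t
      · subst hs; simp
      · have : s - r ≠ t := fun e => hs (by rw [← e]; abel)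
        simp [hs, this]
  exact LinearMap.congr_fun this x

end Coefficients

/-! ### Derivations of the derived algebra and conjugates of the degree derivations. -/

section Derivations

variable {K : Type*} [Field K] {m : ℕ}

/-- The degree derivation `ad D(u, 0)` of `H_N'`. -/
def adTorus (u : Idx m → K) : derived K m →ₗ[K] derived K m :=
  LieModule.toEnd K (hamiltonian K m) (derived K m) ⟨D u 0, D_zero_mem K u⟩

lemma adTorus_lie (u : Idx m → K) (x y : derived K m) :
    adTorus u ⁅x, y⁆ = ⁅adTorus u x, y⁆ + ⁅x, adTorus u y⁆ :=
  Subtype.ext (leibniz_lie (⟨D u 0, D_zero_mem K u⟩ : hamiltonian K m) x.1 y.1)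

/-- The derivation `σ⁻¹ ∘ ad D(u, 0) ∘ σ`. -/
def conjTorus (σ : derived K m ≃ₗ⁅K⁆ derived K m) (u : Idx m → K) : derived K m →ₗ[K] derived K m :=
  σ.symm.toLinearEquiv.toLinearMap ∘ₗ adTorus u ∘ₗ σ.toLinearEquiv.toLinearMap

lemma conjTorus_apply (σ : derived K m ≃ₗ⁅K⁆ derived K m) (u : Idx m → K) (x : derived K m) :
    conjTorus σ u x = σ.symm (adTorus u (σ x)) := rfl

lemma conjTorus_lie (σ : derived K m ≃ₗ⁅K⁆ derived K m) (u : Idx m → K) (x y : derived K m) :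
    conjTorus σ u ⁅x, y⁆ = ⁅conjTorus σ u x, y⁆ + ⁅x, conjTorus σ u y⁆ := by
  rw [conjTorus_apply, conjTorus_apply, conjTorus_apply, LieEquiv.map_lie, adTorus_lie, map_add,
    LieEquiv.map_lie, LieEquiv.map_lie, LieEquiv.symm_apply_apply, LieEquiv.symm_apply_apply]

lemma conjTorus_pow (σ : derived K m ≃ₗ⁅K⁆ derived K m) (u : Idx m → K) (n : ℕ) (x : derived K m) :
    (conjTorus σ u ^ n) x = σ.symm ((adTorus u ^ n) (σ x)) := by
  induction n with
  | zero => simp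
  | succ n ih =>
    rw [pow_succ', Module.End.mul_apply, ih, pow_succ', Module.End.mul_apply, conjTorus_apply,
      LieEquiv.apply_symm_apply]

variable [CharZero K]

/-- The Leibniz rule on `⁅h s, h t⁆`, read off in degree `s + t + r`; it isolates the component of
`δ` of degree `r`. -/
lemma co_cocycle {δ : derived K m →ₗ[K] derived K m}
    (hδ : ∀ x y, δ ⁅x, y⁆ = ⁅δ x, y⁆ + ⁅x, δ y⁆) (r s t : Idx m → ℤ) :
    (omega m s t : K) * co (δ (hElt K (s + t))) (s + t + r)
      = (omega m (s + r) t : K) * co (δ (hElt K s)) (s + r)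
        + (omega m s (t + r) : K) * co (δ (hElt K t)) (t + r) := by
  have h1 := congrArg (fun x => co x (s + t + r)) (hδ (hElt K s) (hElt K t))
  simp only [hElt_lie, map_smul, map_add, Finsupp.smul_apply, Finsupp.add_apply, smul_eq_mul] at h1
  rw [h1, ← lie_skew, map_neg, Finsupp.neg_apply, co_hElt_lie, co_hElt_lie,
    show s + t + r - t = s + r by abel, show s + t + r - s = t + r by abel]
  simp only [map_add, LinearMap.add_apply, omega_self, omega_swap s t, omega_swap r t,
    Int.cast_add, Int.cast_neg, Int.cast_zero]
  ring

lemma co_inner {δ : derived K m →ₗ[K] derived K m}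
    (hδ : ∀ x y, δ ⁅x, y⁆ = ⁅δ x, y⁆ + ⁅x, δ y⁆) {r : Idx m → ℤ} (hr : r ≠ 0) :
    ∃ c : K, ∀ s, co (δ (hElt K s)) (s + r) = c * (omega m r s : K) :=
  exists_eq_mul_omega hr (f := fun s => co (δ (hElt K s)) (s + r))
    -- The normalization at `-r` holds because it concerns the coefficient in degree `0`, which is
    -- always zero.
    (by simp [co_apply_zero]) (co_cocycle hδ r)

lemma co_diag_add {δ : derived K m →ₗ[K] derived K m}
    (hδ : ∀ x y, δ ⁅x, y⁆ = ⁅δ x, y⁆ + ⁅x, δ y⁆) (s t : Idx m → ℤ) :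
    co (δ (hElt K (s + t))) (s + t) = co (δ (hElt K s)) s + co (δ (hElt K t)) t := by
  refine map_add_of_omega_ne_zero (f := fun s => co (δ (hElt K s)) s) (co_apply_zero _)
    (fun s t hst => ?_) s t
  have h1 := co_cocycle hδ 0 s t
  simp only [add_zero] at h1
  have h2 : (omega m s t : K) ≠ 0 := by exact_mod_cast hst
  exact mul_left_cancel₀ h2 (h1.trans (mul_add _ _ _).symm)

lemma co_apply_eq_sum (δ : derived K m →ₗ[K] derived K m) (x : derived K m) (p : Idx m → ℤ) :
    co (δ x) p = (co x).sum fun q a => a * co (δ (hElt K q)) p := by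
  conv_lhs => rw [eq_sum_co x]
  simp [Finsupp.sum, Finsupp.finsetSum_apply]

/-- A derivation of `H_N'` whose iterates on each `h s` have uniformly bounded support
is diagonal. -/
lemma co_eq_zero_of_locallyFinite {δ : derived K m →ₗ[K] derived K m}
    (hδ : ∀ x y, δ ⁅x, y⁆ = ⁅δ x, y⁆ + ⁅x, δ y⁆)
    (hfin : ∀ s, ∃ F : Finset (Idx m → ℤ), ∀ n p, co ((δ ^ n) (hElt K s)) p ≠ 0 → p ∈ F)
    {s p : Idx m → ℤ} (hps : p ≠ s) : co (δ (hElt K s)) p = 0 := by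
  classical
  choose! c hc using fun (r : Idx m → ℤ) (hr : r ≠ 0) => co_inner hδ hr
  set R : Set (Idx m → ℤ) := {r | r ≠ 0 ∧ c r ≠ 0}
  -- Some coordinate vector `e i` has `omega r (e i) ≠ 0`, so `c r ≠ 0` puts `e i + r` in the finite
  -- support of `δ (h (e i))`.
  have hRfin : R.Finite := by
    refine (Set.finite_iUnion fun i : Idx m =>
      ((co (δ (hElt K (Pi.single i 1)))).support.finite_toSet.preimage
        (f := fun r => Pi.single i 1 + r) (add_right_injective _).injOn)).subset ?_
    rintro r ⟨hr, hcr⟩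
    obtain ⟨i, hi⟩ := Function.ne_iff.mp (J_mulVec_ne_zero hr)
    refine Set.mem_iUnion.mpr ⟨i, ?_⟩
    simp only [Set.mem_preimage, Finset.mem_coe, Finsupp.mem_support_iff, hc r hr]
    refine mul_ne_zero hcr ?_
    rw [omega_apply, dotProduct_single, mul_one]
    exact_mod_cast hi
  have hstep : ∀ q p, co (δ (hElt K q)) p ≠ 0 → p = q ∨ p - q ∈ R := by
    intro q p hqp
    by_cases e : p = q
    · exact Or.inl e
    · refine Or.inr ⟨sub_ne_zero.mpr e, fun h0 => hqp ?_⟩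
      have := hc (p - q) (sub_ne_zero.mpr e) q
      rwa [add_sub_cancel, h0, zero_mul] at this
  suffices hRe : R = ∅ by
    by_contra h0
    rcases hstep s p h0 with e | e
    · exact hps e
    · rw [hRe] at e; exact e
  by_contra hne
  -- A weight `w` that is nonzero and injective on `R`; up to its sign, an element of largest
  -- absolute weight is then the unique element of maximal weight.
  obtain ⟨w, hw⟩ := exists_dotProduct_ne_zero
    (hRfin.toFinset ∪ ((hRfin.toFinset ×ˢ hRfin.toFinset).image fun a => a.1 - a.2).erase 0)
    (by
      intro v hv
      simp only [Finset.mem_union, Finset.mem_erase] at hv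
      rcases hv with hv | hv
      · exact ((Set.Finite.mem_toFinset hRfin).mp hv).1
      · exact hv.1)
  have hw0 : ∀ a ∈ R, a ⬝ᵥ w ≠ 0 := fun a ha => hw a (by simp [ha])
  have hw1 : ∀ a ∈ R, ∀ b ∈ R, a ⬝ᵥ w = b ⬝ᵥ w → a = b := by
    intro a ha b hb e
    by_contra hab
    refine hw (a - b) ?_ (by rw [sub_dotProduct, e, sub_self])
    simp only [Finset.mem_union, Finset.mem_erase, Finset.mem_image, Finset.mem_product,
      Set.Finite.mem_toFinset]
    exact Or.inr ⟨sub_ne_zero.mpr hab, (a, b), ⟨ha, hb⟩, rfl⟩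
  obtain ⟨r, hr, hmax⟩ := hRfin.exists_maximalFor (fun r => |r ⬝ᵥ w|) R
    (Set.nonempty_iff_ne_empty.mpr hne)
  obtain ⟨w', hw', hpos⟩ : ∃ w' : Idx m → ℤ, (w' = w ∨ w' = -w) ∧ 0 < r ⬝ᵥ w' := by
    rcases lt_or_gt_of_ne (hw0 r hr) with hlt | hgt
    · exact ⟨-w, Or.inr rfl, by rw [dotProduct_neg]; omega⟩
    · exact ⟨w, Or.inl rfl, hgt⟩
  have habs : ∀ a, |a ⬝ᵥ w'| = |a ⬝ᵥ w| := by
    intro a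
    rcases hw' with rfl | rfl
    · rfl
    · rw [dotProduct_neg, abs_neg]
  have hlt : ∀ a ∈ R, a ≠ r → a ⬝ᵥ w' < r ⬝ᵥ w' := by
    intro a ha har
    have h1 : |a ⬝ᵥ w| ≤ |r ⬝ᵥ w| := by
      rcases le_total |a ⬝ᵥ w| |r ⬝ᵥ w| with h | h
      · exact h
      · exact hmax ha h
    rw [← habs, ← habs, abs_of_pos hpos] at h1
    refine lt_of_le_of_ne ((le_abs_self _).trans h1) fun e => har (hw1 a ha r hr ?_)
    rcases hw' with rfl | rfl
    · exact e
    · simpa [dotProduct_neg] using e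
  obtain ⟨s, hs⟩ := exists_omega_ne_zero_one hr.1
  have hsK : (omega m r s : K) ≠ 0 := by exact_mod_cast hs
  have hs0 : s ≠ 0 := by rintro rfl; simp at hs
  -- The leading term of `δ ^ n (h s)` sits at `s + n r`. Each step multiplies its coefficient by `c
  -- r * omega r (s + n r) = c r * omega r s ≠ 0`.
  have key : ∀ n : ℕ, co ((δ ^ n) (hElt K s)) (s + n • r) ≠ 0 ∧
      ∀ p, co ((δ ^ n) (hElt K s)) p ≠ 0 → p = s + n • r ∨ p ⬝ᵥ w' < (s + n • r) ⬝ᵥ w' := by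
    intro n
    induction n with
    | zero =>
      refine ⟨by simp [co_hElt hs0], fun p hp => Or.inl ?_⟩
      rw [pow_zero, Module.End.one_apply, co_hElt hs0] at hp
      by_contra hne
      exact hp (Finsupp.single_eq_of_ne (by simpa using hne))
    | succ n ih =>
      have hsucc : s + (n + 1) • r = s + n • r + r := by rw [succ_nsmul]; abel
      rw [hsucc, pow_succ', Module.End.mul_apply]
      set q₀ := s + n • r with hq₀
      have hle : ∀ q p, co ((δ ^ n) (hElt K s)) q ≠ 0 → co (δ (hElt K q)) p ≠ 0 →
          (p = q₀ + r ∧ q = q₀) ∨ p ⬝ᵥ w' < (q₀ + r) ⬝ᵥ w' := by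
        intro q p hq hp
        have h1 := ih.2 q hq
        have h2 : p - q = r ∨ (p - q) ⬝ᵥ w' < r ⬝ᵥ w' := by
          rcases hstep q p hp with e | e
          -- The diagonal part of `δ` raises the weight by `0`, less than the positive weight of
          -- `r`.
          · right; rw [e, sub_self, zero_dotProduct]; exact hpos
          · by_cases er : p - q = r
            · exact Or.inl er
            · exact Or.inr (hlt _ e er)
        rw [add_dotProduct]
        rw [sub_dotProduct] at h2
        rcases h1 with rfl | h1
        · rcases h2 with h2 | h2
          · exact Or.inl ⟨by rw [← h2]; abel, rfl⟩
          · right; omega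
        · rcases h2 with h2 | h2
          · right
            have : p = q + r := by rw [← h2]; abel
            rw [this, add_dotProduct]; omega
          · right; omega
      constructor
      · rw [co_apply_eq_sum, Finsupp.sum, Finset.sum_eq_single q₀]
        · refine mul_ne_zero ih.1 ?_
          rw [hc r hr.1]
          refine mul_ne_zero hr.2 ?_
          rw [hq₀, map_add, map_nsmul, omega_self, nsmul_zero, add_zero]
          exact hsK
        · intro q hq hqne
          by_contra h0
          rcases hle q (q₀ + r) (Finsupp.mem_support_iff.mp hq) (right_ne_zero_of_mul h0) with e | e
          · exact hqne e.2
          · exact lt_irrefl _ e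
        · intro h0
          exact absurd (Finsupp.mem_support_iff.mpr ih.1) h0
      · intro p hp
        rw [co_apply_eq_sum, Finsupp.sum] at hp
        obtain ⟨q, hq, hqp⟩ := Finset.exists_ne_zero_of_sum_ne_zero hp
        rcases hle q p (Finsupp.mem_support_iff.mp hq) (right_ne_zero_of_mul hqp) with e | e
        · exact Or.inl e.1
        · exact Or.inr e
  obtain ⟨F, hF⟩ := hfin s
  refine Set.infinite_of_injective_forall_mem (f := fun n : ℕ => s + n • r) (s := (F : Set _)) ?_
    (fun n => hF n _ (key n).1) F.finite_toSet
  intro a b e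
  obtain ⟨i, hi⟩ := Function.ne_iff.mp hr.1
  have h1 := congrFun (add_left_cancel e : a • r = b • r) i
  simp only [Pi.smul_apply, nsmul_eq_mul] at h1
  exact_mod_cast mul_right_cancel₀ hi h1

lemma adTorus_hElt (u : Idx m → K) (s : Idx m → ℤ) :
    adTorus u (hElt K s) = (u ⬝ᵥ fun i => (s i : K)) • hElt K s :=
  Subtype.ext (Subtype.ext (D_zero_h u s))

lemma co_adTorus (u : Idx m → K) (x : derived K m) (p : Idx m → ℤ) :
    co (adTorus u x) p = (u ⬝ᵥ fun i => (p i : K)) * co x p := by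
  have : Finsupp.lapply p ∘ₗ co ∘ₗ adTorus u
      = (u ⬝ᵥ fun i => (p i : K)) • (Finsupp.lapply p ∘ₗ co) := by
    refine linearMap_ext_hElt fun s hs => ?_
    simp only [LinearMap.comp_apply, adTorus_hElt, map_smul, LinearMap.smul_apply,
      Finsupp.lapply_apply, co_hElt hs, smul_eq_mul]
    by_cases hps : p = s
    · rw [hps]
    · simp [Finsupp.single_eq_of_ne hps]
  exact LinearMap.congr_fun this x

lemma co_adTorus_pow (u : Idx m → K) (n : ℕ) (x : derived K m) (p : Idx m → ℤ) :
    co ((adTorus u ^ n) x) p = (u ⬝ᵥ fun i => (p i : K)) ^ n * co x p := by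
  induction n with
  | zero => simp
  | succ n ih => rw [pow_succ', Module.End.mul_apply, co_adTorus, ih, pow_succ', mul_assoc]

variable (σ : derived K m ≃ₗ⁅K⁆ derived K m)

/-- Powers of `adTorus u` only rescale coefficients, so they keep the support of `σ (h s)`; applying
`σ.symm` to the finitely many `h q` in it bounds all iterates. -/
lemma conjTorus_locallyFinite (u : Idx m → K) (s : Idx m → ℤ) :
    ∃ F : Finset (Idx m → ℤ), ∀ n p, co ((conjTorus σ u ^ n) (hElt K s)) p ≠ 0 → p ∈ F := by
  classical
  refine ⟨(co (σ (hElt K s))).support.biUnion fun q => (co (σ.symm (hElt K q))).support, ?_⟩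
  intro n p hp
  have hsupp : ∀ q, co ((adTorus u ^ n) (σ (hElt K s))) q ≠ 0 → co (σ (hElt K s)) q ≠ 0 := by
    intro q hq
    rw [co_adTorus_pow] at hq
    exact right_ne_zero_of_mul hq
  rw [conjTorus_pow] at hp
  have h1 := co_apply_eq_sum σ.symm.toLinearEquiv.toLinearMap
    ((adTorus u ^ n) (σ (hElt K s))) p
  change co (σ.symm _) p = _ at h1
  rw [h1] at hp
  obtain ⟨q, hq, hqp⟩ := Finset.exists_ne_zero_of_sum_ne_zero hp
  exact Finset.mem_biUnion.mpr ⟨q, Finsupp.mem_support_iff.mpr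
    (hsupp q (Finsupp.mem_support_iff.mp hq)),
    Finsupp.mem_support_iff.mpr (right_ne_zero_of_mul hqp)⟩

lemma adTorus_apply_image (u : Idx m → K) (s : Idx m → ℤ) :
    adTorus u (σ (hElt K s)) = co (conjTorus σ u (hElt K s)) s • σ (hElt K s) := by
  by_cases hs : s = 0
  · simp [hs, hElt_zero]
  have h1 : conjTorus σ u (hElt K s) = co (conjTorus σ u (hElt K s)) s • hElt K s := by
    apply co_injective
    ext p
    rw [map_smul, co_hElt hs, Finsupp.smul_apply, smul_eq_mul]
    by_cases hp : p = s
    · simp [hp]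
    · rw [Finsupp.single_eq_of_ne hp, mul_zero]
      exact co_eq_zero_of_locallyFinite (conjTorus_lie σ u) (conjTorus_locallyFinite σ u) hp
  have h2 := congrArg σ h1
  rwa [conjTorus_apply, LieEquiv.apply_symm_apply, map_smul, ← conjTorus_apply] at h2

/-- Every automorphism permutes the lines spanned by the `h s`. -/
lemma exists_image_hElt :
    ∃ q : (Idx m → ℤ) →ₗ[ℤ] (Idx m → ℤ), ∀ s, ∃ a : Kˣ, σ (hElt K s) = a • hElt K (q s) := by
  classical
  let τ : Idx m → (Idx m → ℤ) → K := fun i s => co (conjTorus σ (Pi.single i 1) (hElt K s)) s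
  have hτadd : ∀ i s t, τ i (s + t) = τ i s + τ i t := fun i =>
    co_diag_add (conjTorus_lie σ (Pi.single i 1))
  have hq : ∀ s, ∃ p : Idx m → ℤ, (∀ i, (p i : K) = τ i s) ∧
      ∃ a : Kˣ, σ (hElt K s) = a • hElt K p := by
    intro s
    by_cases hs : s = 0
    · subst hs
      refine ⟨0, fun i => ?_, 1, by simp [hElt_zero]⟩
      have := hτadd i 0 0
      simp at this
      simp [this]
    -- The eigenvalue `τ i s` of the `i`-th degree derivation on `σ (h s)` determines `p i`, as `ℤ`
    -- embeds in `K`; so the support is a single point.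
    have hsupp : ∀ p, co (σ (hElt K s)) p ≠ 0 → ∀ i, (p i : K) = τ i s := by
      intro p hp i
      have h1 := congrArg (fun x => co x p) (adTorus_apply_image σ (Pi.single i 1) s)
      simp only [co_adTorus, map_smul, Finsupp.smul_apply, smul_eq_mul] at h1
      simpa using mul_right_cancel₀ hp h1
    have hne : σ (hElt K s) ≠ 0 := fun e => hElt_ne_zero hs (σ.injective (e.trans (map_zero σ).symm))
    have hco : co (σ (hElt K s)) ≠ 0 := fun e => hne (co_injective (e.trans (map_zero co).symm))
    obtain ⟨p, hp⟩ := Finsupp.ne_iff.mp hco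
    rw [Finsupp.zero_apply] at hp
    refine ⟨p, hsupp p hp, Units.mk0 _ hp, ?_⟩
    have hp0 : p ≠ 0 := by rintro rfl; exact hp (co_apply_zero _)
    apply co_injective
    rw [Units.smul_mk0, map_smul, co_hElt hp0]
    ext p'
    by_cases hp' : p' = p
    · simp [hp']
    · rw [Finsupp.smul_apply, Finsupp.single_eq_of_ne hp', smul_zero]
      by_contra h0
      refine hp' (funext fun i => ?_)
      exact_mod_cast (hsupp p' h0 i).trans (hsupp p hp i).symm
  choose q hq1 hq2 using hq
  refine ⟨(AddMonoidHom.mk' q fun s t => funext fun i => ?_).toIntLinearMap, hq2⟩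
  have : (q (s + t) i : K) = ((q s i + q t i : ℤ) : K) := by
    rw [Int.cast_add, hq1, hq1, hq1, hτadd]
  exact_mod_cast this

end Derivations

/-! ### Similitudes of the symplectic form. -/

section Similitudes

variable {m : ℕ}

lemma omega_inl_inl (i j : Fin m) :
    omega m (Pi.single (Sum.inl i) 1) (Pi.single (Sum.inl j) 1) = 0 := by
  simp [omega_apply, J]

lemma omega_inr_inr (i j : Fin m) :
    omega m (Pi.single (Sum.inr i) 1) (Pi.single (Sum.inr j) 1) = 0 := by
  simp [omega_apply, J]

lemma omega_inl_inr (i j : Fin m) :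
    omega m (Pi.single (Sum.inl i) 1) (Pi.single (Sum.inr j) 1) = if i = j then -1 else 0 := by
  simp [omega_apply, J, Matrix.one_apply, eq_comm]
  split_ifs <;> simp

/-- A bilinear form vanishing on all `omega`-orthogonal pairs is a multiple of `omega`. -/
lemma eq_smul_omega (hm : 1 ≤ m) (B : (Idx m → ℤ) →ₗ[ℤ] (Idx m → ℤ) →ₗ[ℤ] ℤ)
    (hB : ∀ s t, omega m s t = 0 → B s t = 0) :
    ∃ c : ℤ, ∀ s t, B s t = c * omega m s t := by
  have hswap : ∀ s t, B t s = -B s t := by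
    intro s t
    have h1 := hB (s + t) (s + t) (omega_self _)
    simp only [map_add, LinearMap.add_apply, hB s s (omega_self s), hB t t (omega_self t)] at h1
    omega
  have hdiag : ∀ i j : Fin m, B (Pi.single (Sum.inl i) 1) (Pi.single (Sum.inr i) 1)
      = B (Pi.single (Sum.inl j) 1) (Pi.single (Sum.inr j) 1) := by
    intro i j
    by_cases hij : i = j
    · rw [hij]
    -- For a symplectic basis `e i, f i`, the vectors `e i + e j` and `f i - f j` are orthogonal,
    -- which equates `B (e i) (f i)` and `B (e j) (f j)`.
    have h1 := hB (Pi.single (Sum.inl i) 1 + Pi.single (Sum.inl j) 1)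
      (Pi.single (Sum.inr i) 1 - Pi.single (Sum.inr j) 1)
      (by simp [omega_inl_inr, hij, Ne.symm hij])
    have h2 := hB (Pi.single (Sum.inl i) 1) (Pi.single (Sum.inr j) 1)
      (by simp [omega_inl_inr, hij])
    have h3 := hB (Pi.single (Sum.inl j) 1) (Pi.single (Sum.inr i) 1)
      (by simp [omega_inl_inr, Ne.symm hij])
    simp only [map_add, map_sub, LinearMap.add_apply, h2, h3] at h1
    omega
  let z : Fin m := ⟨0, hm⟩
  refine ⟨-B (Pi.single (Sum.inl z) 1) (Pi.single (Sum.inr z) 1), ?_⟩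
  have hlr : ∀ i j : Fin m, B (Pi.single (Sum.inl i) 1) (Pi.single (Sum.inr j) 1)
      = -B (Pi.single (Sum.inl z) 1) (Pi.single (Sum.inr z) 1)
        * omega m (Pi.single (Sum.inl i) 1) (Pi.single (Sum.inr j) 1) := by
    intro i j
    rw [omega_inl_inr]
    by_cases hij : i = j
    · subst hij
      rw [hdiag i z]; simp
    · simp only [hij, if_false, mul_zero]
      exact hB _ _ (by simp [omega_inl_inr, hij])
  suffices h : B = (-B (Pi.single (Sum.inl z) 1) (Pi.single (Sum.inr z) 1)) • omega m by
    intro s t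
    conv_lhs => rw [h]
    rfl
  refine (Pi.basisFun ℤ (Idx m)).ext fun a => (Pi.basisFun ℤ (Idx m)).ext fun b => ?_
  simp only [Pi.basisFun_apply, LinearMap.smul_apply, smul_eq_mul]
  rcases a with i | i <;> rcases b with j | j
  · rw [omega_inl_inl, mul_zero, hB _ _ (omega_inl_inl i j)]
  · exact hlr i j
  · rw [hswap, omega_swap (Pi.single (Sum.inl j) 1), hlr, mul_neg]
  · rw [omega_inr_inr, mul_zero, hB _ _ (omega_inr_inr i j)]

lemma omega_mulVec (Q : Matrix (Idx m) (Idx m) ℤ) (s t : Idx m → ℤ) :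
    omega m (Q *ᵥ s) (Q *ᵥ t) = ((Qᵀ * J m * Q) *ᵥ s) ⬝ᵥ t := by
  rw [omega_apply, Matrix.dotProduct_mulVec, ← Matrix.mulVec_transpose, Matrix.mulVec_mulVec,
    Matrix.mulVec_mulVec]

lemma similitude_iff (Q : Matrix (Idx m) (Idx m) ℤ) (c : ℤ) :
    Qᵀ * J m * Q = c • J m ↔ ∀ s t, omega m (Q *ᵥ s) (Q *ᵥ t) = c * omega m s t := by
  constructor
  · intro hQ s t
    rw [omega_mulVec, hQ, Matrix.smul_mulVec, smul_dotProduct]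
    rfl
  · intro hQ
    ext i j
    have h1 := hQ (Pi.single j 1) (Pi.single i 1)
    rw [omega_mulVec, omega_apply] at h1
    simpa using h1

lemma J_ne_zero (hm : 1 ≤ m) : J m ≠ 0 := by
  intro h0
  have := omega_inl_inr (⟨0, hm⟩ : Fin m) ⟨0, hm⟩
  simp [omega_apply, h0] at this

lemma similitude_unique (hm : 1 ≤ m) {Q : Matrix (Idx m) (Idx m) ℤ} {c c' : ℤˣ}
    (h : Qᵀ * J m * Q = (c : ℤ) • J m) (h' : Qᵀ * J m * Q = (c' : ℤ) • J m) : c = c' := by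
  rw [h, ← sub_eq_zero, ← sub_smul, smul_eq_zero, sub_eq_zero] at h'
  exact Units.ext (h'.resolve_right (J_ne_zero hm))

end Similitudes

/-! ### Characters of the lattice as torus elements. -/

section Characters

variable {K : Type*} [Field K] {m : ℕ}

lemma exists_tpow {f : (Idx m → ℤ) → Kˣ} (hf : ∀ s t, f (s + t) = f s * f t) :
    ∃ l : Torus K m, ∀ s, f s = tpow l s := by
  let g : (Idx m → ℤ) →ₗ[ℤ] Additive Kˣ :=
    (AddMonoidHom.mk' (fun s => Additive.ofMul (f s)) fun s t => by rw [hf]; rfl).toIntLinearMap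
  refine ⟨fun i => f fun j => if i = j then 1 else 0, fun s => ?_⟩
  have h1 := congrArg Additive.toMul (LinearMap.pi_apply_eq_sum_univ g s)
  rw [toMul_sum] at h1
  exact h1

lemma tpow_add (l : Torus K m) (r s : Idx m → ℤ) : tpow l (r + s) = tpow l r * tpow l s := by
  simp [tpow, zpow_add, Finset.prod_mul_distrib]

lemma tpow_one (r : Idx m → ℤ) : tpow (1 : Torus K m) r = 1 := by
  simp [tpow]

lemma torus_ext_of_ne_zero {l l' : Torus K m} (hl : ∀ r, r ≠ 0 → tpow l r = tpow l' r) :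
    l = l' :=
  torus_ext fun r => by
    by_cases hr : r = 0
    · simp [hr, tpow]
    · exact hl r hr

/-- The sign `±1` as a unit of `K`. -/
abbrev signUnit (K : Type*) [Field K] : ℤˣ →* Kˣ := Units.map (Int.castRingHom K).toMonoidHom

/-- The character with value `c` on the coordinate vectors. -/
def signTorus (K : Type*) [Field K] (m : ℕ) (c : ℤˣ) : Torus K m := fun _ => signUnit K c

lemma tpow_signTorus (c : ℤˣ) (r : Idx m → ℤ) :
    tpow (signTorus K m c) r = signUnit K c ^ (∑ i, r i) :=
  (map_sum (zmultiplesHom (Additive Kˣ) (Additive.ofMul (signUnit K c))) r Finset.univ).symm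

end Characters

/-! ### Every automorphism is monomial. -/

section Classification

variable {K : Type*} [Field K] [CharZero K] {m : ℕ}

lemma unit_smul_hElt_eq {a b : Kˣ} {r s : Idx m → ℤ} (hr : r ≠ 0)
    (e : a • hElt K r = b • hElt K s) : r = s ∧ a = b := by
  have hs : s ≠ 0 := by
    rintro rfl
    rw [hElt_zero, smul_zero] at e
    exact hElt_ne_zero hr ((smul_eq_zero_iff_eq a).mp e)
  obtain ⟨h1, h2⟩ := smul_hElt_eq hr hs a.ne_zero e
  exact ⟨h1, Units.ext h2⟩

/-- Every automorphism of `H_N'` is monomial. -/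
theorem exists_monomial_form (hm : 1 ≤ m) (σ : LieAut K (derived K m)) :
    ∃ (Q : GSp m) (l : Torus K m) (c : ℤˣ), (Q.1.val)ᵀ * J m * Q.1.val = (c : ℤ) • J m ∧
      ∀ r, σ (hElt K r) = (signUnit K c * tpow l r) • hElt K (Q.1.val *ᵥ r) := by
  classical
  have hinv : ∀ (τ : LieAut K (derived K m)) (q q' : (Idx m → ℤ) →ₗ[ℤ] (Idx m → ℤ)),
      (∀ s, ∃ a : Kˣ, τ (hElt K s) = a • hElt K (q s)) →
      (∀ s, ∃ a : Kˣ, τ.symm (hElt K s) = a • hElt K (q' s)) → ∀ s, q' (q s) = s := by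
    intro τ q q' hq hq' s
    by_cases hs : s = 0
    · simp [hs]
    obtain ⟨a, ha⟩ := hq s
    obtain ⟨a', ha'⟩ := hq' (q s)
    have h1 : (1 : Kˣ) • hElt K s = (a * a') • hElt K (q' (q s)) := by
      rw [one_smul, ← τ.symm_apply_apply (hElt K s), ha, Units.smul_def, map_smul, ha', mul_smul]
      rfl
    exact (unit_smul_hElt_eq hs h1).1.symm
  have hsim : ∀ (τ : LieAut K (derived K m)) (q : (Idx m → ℤ) →ₗ[ℤ] (Idx m → ℤ)) (a : _ → Kˣ),
      (∀ s, q s = 0 → s = 0) → (∀ s, τ (hElt K s) = a s • hElt K (q s)) →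
      ∀ s t, s + t ≠ 0 → (a s : K) * a t * (omega m (q s) (q t) : K)
        = (omega m s t : K) * a (s + t) := by
    intro τ q a hq ha s t hst
    have h1 : τ ⁅hElt K s, hElt K t⁆ = ⁅τ (hElt K s), τ (hElt K t)⁆ := τ.map_lie _ _
    rw [hElt_lie, map_smul, ha, ha, ha, Units.smul_def, Units.smul_def, Units.smul_def, lie_smul,
      smul_lie, hElt_lie, smul_smul, smul_smul, smul_smul, ← map_add] at h1
    have h2 := congrArg (fun x => co x (q (s + t))) h1
    simp only [map_smul, co_hElt (fun e => hst (hq _ e)), Finsupp.smul_apply,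
      Finsupp.single_eq_same, smul_eq_mul, mul_one] at h2
    linear_combination -h2
  have hform : ∀ (τ : LieAut K (derived K m)) (q : (Idx m → ℤ) →ₗ[ℤ] (Idx m → ℤ)),
      (∀ s, q s = 0 → s = 0) → (∀ s, ∃ a : Kˣ, τ (hElt K s) = a • hElt K (q s)) →
      ∃ c : ℤ, ∀ s t, omega m (q s) (q t) = c * omega m s t := by
    intro τ q hq hqa
    choose a ha using hqa
    refine eq_smul_omega hm ((omega m).compl₁₂ q q) fun s t hst => ?_
    rw [LinearMap.compl₁₂_apply]
    by_cases h0 : s + t = 0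
    -- For `t = -s` the bracket carries no information, since `h 0 = 0`, but the form vanishes
    -- anyway.
    · rw [eq_neg_of_add_eq_zero_right h0, map_neg, map_neg, omega_self, neg_zero]
    · have h1 := hsim τ q a hq ha s t h0
      rw [hst, Int.cast_zero, zero_mul] at h1
      exact_mod_cast (mul_eq_zero.mp h1).resolve_left (mul_ne_zero (a s).ne_zero (a t).ne_zero)
  obtain ⟨q, hq⟩ := exists_image_hElt σ
  obtain ⟨q', hq'⟩ := exists_image_hElt σ.symm
  have hl : ∀ s, q' (q s) = s := hinv σ q q' hq hq'
  have hr : ∀ s, q (q' s) = s := hinv σ.symm q' q hq' hq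
  have hq0 : ∀ s, q s = 0 → s = 0 := fun s e => by rw [← hl s, e, map_zero]
  have hq0' : ∀ s, q' s = 0 → s = 0 := fun s e => by rw [← hr s, e, map_zero]
  obtain ⟨c, hc⟩ := hform σ q hq0 hq
  obtain ⟨c', hc'⟩ := hform σ.symm q' hq0' hq'
  have hcc : c * c' = 1 := by
    have h1 := hc' (q (Pi.single (Sum.inl ⟨0, hm⟩) 1)) (q (Pi.single (Sum.inr ⟨0, hm⟩) 1))
    rw [hl, hl, hc, omega_inl_inr, if_pos rfl] at h1
    linarith
  let u : ℤˣ := Units.mkOfMulEqOne c c' hcc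
  have hu : (u : ℤ) = c := rfl
  let Q : GL (Idx m) ℤ := ⟨LinearMap.toMatrix' q, LinearMap.toMatrix' q', by
      rw [← LinearMap.toMatrix'_comp, show q ∘ₗ q' = LinearMap.id from LinearMap.ext hr,
        LinearMap.toMatrix'_id], by
      rw [← LinearMap.toMatrix'_comp, show q' ∘ₗ q = LinearMap.id from LinearMap.ext hl,
        LinearMap.toMatrix'_id]⟩
  have hQ : ∀ s, Q.val *ᵥ s = q s := fun s => LinearMap.toMatrix'_mulVec q s
  have hQs : (Q.val)ᵀ * J m * Q.val = (u : ℤ) • J m := by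
    rw [similitude_iff]
    intro s t
    rw [hQ, hQ, hc, hu]
  choose a ha using hq
  -- The relation `a (s + t) = u * a s * a t` makes `u * a` multiplicative because `u ^ 2 = 1`. The
  -- scalar `a 0` is arbitrary, so the value at `0` is set to `1`.
  let f : (Idx m → ℤ) → Kˣ := fun s => if s = 0 then 1 else signUnit K u * a s
  have hadd : ∀ s t, f (s + t) = f s * f t := by
    refine map_add_of_omega_ne_zero (A := Additive Kˣ) (f := f) (if_pos rfl) fun s t hst => ?_
    change f (s + t) = f s * f t
    have hs : s ≠ 0 := by rintro rfl; simp at hst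
    have ht : t ≠ 0 := by rintro rfl; simp at hst
    have h0 : s + t ≠ 0 := by
      intro h0
      rw [eq_neg_of_add_eq_zero_right h0, map_neg, omega_self, neg_zero] at hst
      exact hst rfl
    have h1 := hsim σ q a hq0 ha s t h0
    have h2 : (omega m s t : K) ≠ 0 := by exact_mod_cast hst
    have h3 : (a (s + t) : K) = (u : ℤ) * (a s * a t) := by
      apply mul_left_cancel₀ h2
      rw [← h1, hc, hu, Int.cast_mul]
      ring
    simp only [f, if_neg hs, if_neg ht, if_neg h0]
    have h4 : a (s + t) = signUnit K u * (a s * a t) := Units.ext h3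
    rw [h4]
    ac_rfl
  obtain ⟨l, hl⟩ := exists_tpow hadd
  refine ⟨⟨Q, u, hQs⟩, l, u, hQs, fun r => ?_⟩
  change _ = _ • hElt K (Q.val *ᵥ r)
  rw [hQ, ha]
  by_cases h0 : r = 0
  · simp [h0, hElt_zero]
  · rw [← hl r]
    simp only [f, if_neg h0]
    rw [← mul_assoc, ← map_mul, Int.units_mul_self, map_one, one_mul]

end Classification

/-! ### Monomial maps are automorphisms. -/

section Construction

variable {K : Type*} [Field K] [CharZero K] {m : ℕ}

/-- The endomorphism of `H_N'` determined by compatible images of the `h r`. -/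
def liftHom (φ : (Idx m → ℤ) → derived K m) (h0 : φ 0 = 0)
    (hφ : ∀ r s, ⁅φ r, φ s⁆ = (omega m r s : K) • φ (r + s)) : derived K m →ₗ⁅K⁆ derived K m :=
  let f : derived K m →ₗ[K] derived K m := (hBasis K m).constr K fun r => φ r.1
  have hf : ∀ r, f (hElt K r) = φ r := fun r => by
    by_cases hr : r = 0
    · rw [hr, hElt_zero, map_zero, h0]
    · simpa using (hBasis K m).constr_basis K (fun r => φ r.1) ⟨r, hr⟩
  -- Bracket compatibility passes from the basis to all elements one variable at a time.
  have h1 : ∀ r y, f ⁅hElt K r, y⁆ = ⁅f (hElt K r), f y⁆ := fun r y => by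
    have : f ∘ₗ (LieAlgebra.ad K (derived K m) (hElt K r) : derived K m →ₗ[K] derived K m)
        = (LieAlgebra.ad K (derived K m) (f (hElt K r)) : derived K m →ₗ[K] derived K m) ∘ₗ f :=
      linearMap_ext_hElt fun s _ => by
        simp only [LinearMap.comp_apply, LieAlgebra.ad_apply, hElt_lie, map_smul, hf, hφ]
    exact LinearMap.congr_fun this y
  { f with
    map_lie' := fun {x y} => by
      change f ⁅x, y⁆ = ⁅f x, f y⁆
      have : f ∘ₗ (LieAlgebra.ad K (derived K m) x : derived K m →ₗ[K] derived K m)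
          = (LieAlgebra.ad K (derived K m) (f x) : derived K m →ₗ[K] derived K m) ∘ₗ f :=
        linearMap_ext_hElt fun s _ => by
          simp only [LinearMap.comp_apply, LieAlgebra.ad_apply]
          rw [← lie_skew, map_neg, h1, lie_skew]
      exact LinearMap.congr_fun this y }

lemma liftHom_hElt (φ : (Idx m → ℤ) → derived K m) (h0 : φ 0 = 0)
    (hφ : ∀ r s, ⁅φ r, φ s⁆ = (omega m r s : K) • φ (r + s)) (r : Idx m → ℤ) :
    liftHom φ h0 hφ (hElt K r) = φ r := by
  change (hBasis K m).constr K (fun r => φ r.1) (hElt K r) = φ r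
  by_cases hr : r = 0
  · rw [hr, hElt_zero, map_zero, h0]
  · simpa using (hBasis K m).constr_basis K (fun r => φ r.1) ⟨r, hr⟩

/-- The endomorphism `h r ↦ c * l ^ r * h (Q r)`. -/
def monoHom (Q : Matrix (Idx m) (Idx m) ℤ) (c : ℤˣ) (hQ : Qᵀ * J m * Q = (c : ℤ) • J m)
    (l : Torus K m) : derived K m →ₗ⁅K⁆ derived K m :=
  liftHom (fun r => (signUnit K c * tpow l r) • hElt K (Q *ᵥ r))
    (by rw [Matrix.mulVec_zero, hElt_zero, smul_zero]) fun r s => by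
      have h1 : ((c : ℤ) : K) * ((c : ℤ) : K) = 1 := by
        rw [← Int.cast_mul, ← Units.val_mul, Int.units_mul_self, Units.val_one, Int.cast_one]
      have h2 : ((signUnit K c : Kˣ) : K) = ((c : ℤ) : K) := rfl
      simp only [Units.smul_def, lie_smul, smul_lie, hElt_lie, smul_smul, Matrix.mulVec_add,
        (similitude_iff Q c).mp hQ, tpow_add, Units.val_mul, h2, Int.cast_mul]
      congr 1
      linear_combination (c : ℤ) * (tpow l r : K) * tpow l s * omega m r s * h1

lemma monoHom_hElt (Q : Matrix (Idx m) (Idx m) ℤ) (c : ℤˣ) (hQ : Qᵀ * J m * Q = (c : ℤ) • J m)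
    (l : Torus K m) (r : Idx m → ℤ) :
    monoHom Q c hQ l (hElt K r) = (signUnit K c * tpow l r) • hElt K (Q *ᵥ r) :=
  liftHom_hElt _ _ _ r

lemma similitude_inv {Q : GL (Idx m) ℤ} {c : ℤˣ}
    (hQ : (Q.val)ᵀ * J m * Q.val = (c : ℤ) • J m) :
    ((Q⁻¹).val)ᵀ * J m * (Q⁻¹).val = (c : ℤ) • J m := by
  rw [similitude_iff] at hQ ⊢
  intro s t
  have h1 := hQ ((Q⁻¹).val *ᵥ s) ((Q⁻¹).val *ᵥ t)
  rw [Matrix.mulVec_mulVec, Matrix.mulVec_mulVec, Q.mul_inv, Matrix.one_mulVec,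
    Matrix.one_mulVec] at h1
  rw [h1, ← mul_assoc, ← Units.val_mul, Int.units_mul_self, Units.val_one, one_mul]

/-- The automorphism `h r ↦ c * l ^ r * h (Q r)`. -/
def monoAut (Q : GL (Idx m) ℤ) (c : ℤˣ) (hQ : (Q.val)ᵀ * J m * Q.val = (c : ℤ) • J m)
    (l : Torus K m) : LieAut K (derived K m) :=
  let f : derived K m →ₗ⁅K⁆ derived K m := monoHom Q.val c hQ l
  -- The inverse must send `h (Q r)` to `c * l ^ (-r) * h r`, so its character at `r` is that of
  -- `l⁻¹` at `Q⁻¹ r`.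
  let g : derived K m →ₗ⁅K⁆ derived K m := monoHom (Q⁻¹).val c (similitude_inv hQ) (actFun Q l⁻¹)
  have hinv : ∀ r, (l⁻¹ * l : Torus K m) = 1 → tpow l⁻¹ r * tpow l r = 1 := fun r e => by
    rw [← tpow_mul, e, tpow_one]
  { f with
    invFun := g
    left_inv := fun x => by
      have : (g : derived K m →ₗ[K] derived K m) ∘ₗ (f : derived K m →ₗ[K] derived K m)
          = LinearMap.id := linearMap_ext_hElt fun r _ => by
        change g (f (hElt K r)) = hElt K r
        have h1 : (Q⁻¹).val * Q.val = 1 := Q.inv_mul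
        have h2 := hinv r (inv_mul_cancel l)
        simp only [f, g]
        rw [monoHom_hElt, Units.smul_def, map_smul, monoHom_hElt, Matrix.mulVec_mulVec, h1,
          Matrix.one_mulVec, tpow_actFun, Matrix.mulVec_mulVec, h1, Matrix.one_mulVec,
          ← Units.smul_def, smul_smul, mul_mul_mul_comm, ← map_mul, Int.units_mul_self, map_one,
          one_mul, mul_comm, h2, one_smul]
      exact LinearMap.congr_fun this x
    right_inv := fun x => by
      have : (f : derived K m →ₗ[K] derived K m) ∘ₗ (g : derived K m →ₗ[K] derived K m)
          = LinearMap.id := linearMap_ext_hElt fun r _ => by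
        change f (g (hElt K r)) = hElt K r
        have h1 : Q.val * (Q⁻¹).val = 1 := Q.mul_inv
        have h2 := hinv ((Q⁻¹).val *ᵥ r) (inv_mul_cancel l)
        simp only [f, g]
        rw [monoHom_hElt, Units.smul_def, map_smul, monoHom_hElt, Matrix.mulVec_mulVec, h1,
          Matrix.one_mulVec, tpow_actFun,
          ← Units.smul_def, smul_smul, mul_mul_mul_comm, ← map_mul, Int.units_mul_self, map_one,
          one_mul, h2, one_smul]
      exact LinearMap.congr_fun this x }

lemma monoAut_hElt (Q : GL (Idx m) ℤ) (c : ℤˣ) (hQ : (Q.val)ᵀ * J m * Q.val = (c : ℤ) • J m)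
    (l : Torus K m) (r : Idx m → ℤ) :
    monoAut Q c hQ l (hElt K r) = (signUnit K c * tpow l r) • hElt K (Q.val *ᵥ r) :=
  monoHom_hElt Q.val c hQ l r

lemma lieAut_ext {σ τ : LieAut K (derived K m)}
    (hστ : ∀ r, r ≠ 0 → σ (hElt K r) = τ (hElt K r)) : σ = τ := by
  have : σ.toLinearEquiv.toLinearMap = τ.toLinearEquiv.toLinearMap := linearMap_ext_hElt hστ
  ext1 x
  exact LinearMap.congr_fun this x

/-- The matrix and the character of a monomial map are determined by its values. -/
lemma monomial_unique (Q Q' : GL (Idx m) ℤ) {χ χ' : (Idx m → ℤ) → Kˣ}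
    (h : ∀ r, r ≠ 0 → χ r • hElt K (Q.val *ᵥ r) = χ' r • hElt K (Q'.val *ᵥ r)) :
    Q = Q' ∧ ∀ r, r ≠ 0 → χ r = χ' r := by
  have hne : ∀ r, r ≠ 0 → Q.val *ᵥ r ≠ 0 := by
    intro r hr e
    apply hr
    rw [← Matrix.one_mulVec r, ← Q.inv_mul]
    rw [← Matrix.mulVec_mulVec, e, Matrix.mulVec_zero]
  refine ⟨Units.ext (Matrix.ext fun i j => ?_), fun r hr =>
    (unit_smul_hElt_eq (hne r hr) (h r hr)).2⟩
  have hj : (Pi.single j 1 : Idx m → ℤ) ≠ 0 := by simp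
  have h1 := (unit_smul_hElt_eq (hne _ hj) (h _ hj)).1
  simpa using congrFun h1 i

end Construction

/-! ### The isomorphism with the semidirect product. -/

section Group

variable {m : ℕ}

/-- The multiplier of an element of the conformal symplectic group. -/
def multiplier (Q : GSp m) : ℤˣ := Q.2.choose

lemma multiplier_spec (Q : GSp m) :
    (Q.1.val)ᵀ * J m * Q.1.val = (multiplier Q : ℤ) • J m := Q.2.choose_spec

lemma eq_multiplier (hm : 1 ≤ m) {Q : GSp m} {c : ℤˣ}
    (h : (Q.1.val)ᵀ * J m * Q.1.val = (c : ℤ) • J m) : c = multiplier Q :=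
  similitude_unique hm h (multiplier_spec Q)

lemma multiplier_mul (hm : 1 ≤ m) (P Q : GSp m) :
    multiplier (P * Q) = multiplier P * multiplier Q := by
  refine (eq_multiplier hm ((similitude_iff _ _).mpr fun s t => ?_)).symm
  change omega m ((P.1.val * Q.1.val) *ᵥ s) ((P.1.val * Q.1.val) *ᵥ t) = _
  rw [← Matrix.mulVec_mulVec, ← Matrix.mulVec_mulVec,
    (similitude_iff _ _).mp (multiplier_spec P), (similitude_iff _ _).mp (multiplier_spec Q),
    Units.val_mul, mul_assoc]

variable (K : Type*) [Field K] [CharZero K]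

/-- The automorphism attached to an element of the semidirect product. -/
def autFun (g : Torus K m ⋊[act K m] GSp m) : LieAut K (derived K m) :=
  -- The pair `(l, Q)` stands for `l Q = Q (Q⁻¹ · l)`, while `monoAut` expects the torus factor on
  -- the right.
  monoAut g.right.1 (multiplier g.right) (multiplier_spec g.right) (actFun g.right.1⁻¹ g.left)

lemma autFun_hElt (g : Torus K m ⋊[act K m] GSp m) (r : Idx m → ℤ) :
    autFun K g (hElt K r) = (signUnit K (multiplier g.right) * tpow g.left (g.right.1.val *ᵥ r))
      • hElt K (g.right.1.val *ᵥ r) := by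
  rw [autFun, monoAut_hElt, tpow_actFun, inv_inv]

variable {K}

lemma autFun_mul (hm : 1 ≤ m) (g g' : Torus K m ⋊[act K m] GSp m) :
    autFun K (g * g') = autFun K g * autFun K g' := by
  refine lieAut_ext fun r _ => ?_
  change _ = autFun K g (autFun K g' (hElt K r))
  have h1 : (g * g').right.1.val = g.right.1.val * g'.right.1.val := rfl
  have h2 : (g * g').left = g.left * actFun g.right.1 g'.left := rfl
  have h3 : (g * g').right = g.right * g'.right := rfl
  have h4 : (g.right.1⁻¹).val * g.right.1.val = 1 := g.right.1.inv_mul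
  rw [autFun_hElt, autFun_hElt, Units.smul_def _ (hElt K _), Units.smul_def _ (hElt K _), map_smul,
    autFun_hElt, ← Units.smul_def, ← Units.smul_def, smul_smul, h1, ← Matrix.mulVec_mulVec, h2,
    tpow_mul, tpow_actFun, Matrix.mulVec_mulVec, Matrix.mulVec_mulVec, ← Matrix.mul_assoc, h4,
    Matrix.one_mul, h3, multiplier_mul hm, map_mul]
  congr 1
  ac_rfl

lemma autFun_injective :
    Function.Injective (autFun K : (Torus K m ⋊[act K m] GSp m) → _) := by
  intro g g' e
  have h1 : ∀ r : Idx m → ℤ, r ≠ 0 → _ := fun r _ =>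
    (autFun_hElt K g r).symm.trans ((congrArg (fun σ => σ (hElt K r)) e).trans (autFun_hElt K g' r))
  obtain ⟨h2, h3⟩ := monomial_unique (K := K) g.right.1 g'.right.1 h1
  have h4 : g.right = g'.right := Subtype.ext h2
  refine SemidirectProduct.ext (torus_ext_of_ne_zero fun r hr => ?_) h4
  have hne : (g.right.1⁻¹).val *ᵥ r ≠ 0 := by
    intro h0
    apply hr
    rw [← Matrix.one_mulVec r, ← g.right.1.mul_inv]
    rw [← Matrix.mulVec_mulVec, h0, Matrix.mulVec_zero]
  have h5 := h3 _ hne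
  have h6 : g.right.1.val * (g.right.1⁻¹).val = 1 := g.right.1.mul_inv
  rw [← h4] at h5
  have h7 := mul_left_cancel h5
  rwa [Matrix.mulVec_mulVec, h6, Matrix.one_mulVec] at h7

lemma autFun_surjective (hm : 1 ≤ m) :
    Function.Surjective (autFun K : (Torus K m ⋊[act K m] GSp m) → _) := by
  intro σ
  obtain ⟨Q, l, c, hc, hσ⟩ := exists_monomial_form hm σ
  refine ⟨⟨actFun Q.1 l, Q⟩, lieAut_ext fun r _ => ?_⟩
  have h4 : (Q.1⁻¹).val * Q.1.val = 1 := Q.1.inv_mul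
  rw [autFun_hElt, hσ, eq_multiplier hm hc, tpow_actFun, Matrix.mulVec_mulVec, h4,
    Matrix.one_mulVec]

/-- The isomorphism of the semidirect product with the automorphism group of `H_N'`. -/
def autEquiv (hm : 1 ≤ m) : (Torus K m ⋊[act K m] GSp m) ≃* LieAut K (derived K m) :=
  MulEquiv.mk' (Equiv.ofBijective (autFun K) ⟨autFun_injective, autFun_surjective hm⟩)
    (autFun_mul hm)

lemma autEquiv_apply_inr_mul_inl (hm : 1 ≤ m) (Q : GSp m) (l : Torus K m) (r : Idx m → ℤ) :
    autEquiv hm (SemidirectProduct.inr Q * SemidirectProduct.inl l) (hElt K r)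
      = (signUnit K (multiplier Q) * tpow l r) • hElt K (Q.1.val *ᵥ r) := by
  refine (autFun_hElt K _ r).trans ?_
  have h1 : (SemidirectProduct.inr Q * SemidirectProduct.inl l :
      Torus K m ⋊[act K m] GSp m).left = actFun Q.1 l :=
    (SemidirectProduct.mul_left _ _).trans (one_mul _)
  have h2 : (SemidirectProduct.inr Q * SemidirectProduct.inl l :
      Torus K m ⋊[act K m] GSp m).right = Q := by simp
  have h4 : (Q.1⁻¹).val * Q.1.val = 1 := Q.1.inv_mul
  rw [h1, h2, tpow_actFun, Matrix.mulVec_mulVec, h4, Matrix.one_mulVec]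

/-- The sign `-(-1) ^ |r|` is `c = -1` times the character with value `c` on coordinate vectors, a
character that is trivial for `c = 1`. As `J ≠ -J`, exactly one of the two cases applies. -/
lemma isGivenBy_iff (hm : 1 ≤ m) (s : LieAut K (derived K m)) (Q : GSp m) (l : Torus K m) :
    IsGivenBy s Q l ↔ ∀ r, r ≠ 0 → s (hElt K r)
      = (signUnit K (multiplier Q) * tpow (signTorus K m (multiplier Q) * l) r)
        • hElt K (Q.1.val *ᵥ r) := by
  have hJ : J m ≠ -J m := by
    intro e
    have h1 : (2 : ℤ) • J m = 0 := by rw [two_smul]; nth_rw 2 [e]; exact add_neg_cancel _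
    exact J_ne_zero hm ((smul_eq_zero.mp h1).resolve_left two_ne_zero)
  have hs := multiplier_spec Q
  unfold IsGivenBy
  simp only [tpow_mul, tpow_signTorus, Units.smul_def, Units.val_mul, Units.val_zpow_eq_zpow_val]
  rcases Int.units_eq_one_or (multiplier Q) with h1 | h1
  · rw [h1, Units.val_one, one_smul] at hs
    simp [hs, hJ, h1]
  · rw [h1, Units.val_neg, Units.val_one, neg_smul, one_smul] at hs
    simp [hs, hJ.symm, h1]

end Group

end
end TorusHamiltonian

open TorusHamiltonian in
theorem theorem3p4 {K : Type*} [Field K] [IsAlgClosed K] [CharZero K] (m : ℕ) (hm : 1 ≤ m) :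
    (∃ Φ : (Torus K m ⋊[act K m] GSp m) ≃* LieAut K (derived K m),
      ∀ (Q : GSp m) (l : Torus K m) (c : ℤˣ),
        (Q.1.val)ᵀ * J m * Q.1.val = (c : ℤ) • J m →
          ∀ r : Idx m → ℤ, r ≠ 0 →
            Φ (SemidirectProduct.inr Q * SemidirectProduct.inl l) (hElt K r)
              = (((c : ℤ) : K) * (tpow l r : K)) • hElt K (Q.1.val *ᵥ r)) ∧
    (∀ s : LieAut K (derived K m), ∃! p : GSp m × Torus K m, IsGivenBy s p.1 p.2) ∧
    (∀ (Q : GSp m) (l : Torus K m), ∃! s : LieAut K (derived K m), IsGivenBy s Q l) := by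
  refine ⟨⟨autEquiv hm, fun Q l c hc r _ => ?_⟩, fun s => ?_, fun Q l => ?_⟩
  · rw [autEquiv_apply_inr_mul_inl, eq_multiplier hm hc]
    rfl
  · obtain ⟨Q, l, c, hc, hs⟩ := exists_monomial_form hm s
    -- Dividing by the sign character passes from the form `c * l ^ r` to the form with `-(-1) ^
    -- |r|`.
    refine ⟨(Q, (signTorus K m c)⁻¹ * l), ?_, ?_⟩
    · refine (isGivenBy_iff hm _ _ _).mpr ?_
      rw [← eq_multiplier hm hc]
      intro r _
      rw [mul_inv_cancel_left]
      exact hs r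
    · rintro ⟨Q', l'⟩ h'
      rw [isGivenBy_iff hm] at h'
      obtain ⟨h1, h2⟩ := monomial_unique (K := K) Q'.1 Q.1 fun r hr =>
        (h' r hr).symm.trans (hs r)
      have h3 : Q' = Q := Subtype.ext h1
      subst h3
      rw [← eq_multiplier hm hc] at h2
      refine Prod.ext rfl (eq_inv_mul_of_mul_eq ?_)
      exact torus_ext_of_ne_zero fun r hr => mul_left_cancel (h2 r hr)
  · refine ⟨monoAut Q.1 _ (multiplier_spec Q) (signTorus K m (multiplier Q) * l), ?_, ?_⟩
    · exact (isGivenBy_iff hm _ _ _).mpr fun r _ => monoAut_hElt _ _ _ _ r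
    · intro s hs
      refine lieAut_ext fun r hr => ?_
      rw [(isGivenBy_iff hm _ _ _).mp hs r hr, monoAut_hElt]
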